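/- Let $\mathfrak g$ be a finite-dimensional simple complex Lie algebra with a symmetric non-degenerate invariant bilinear form $(\cdot,\cdot)$, let $\{X_\lambda\}_{\lambda\in\Lambda}$ be an orthonormal basis, put $\Omega=\sum_\lambda X_\lambda\otimes X_\lambda$, $\omega=\sum_\lambda X_\lambda^2$, and let $c_{\mathfrak g}$ be the eigenvalue of $\omega$ in the adjoint representation. Let $Y(\mathfrak g)$ be the Yangian in its $J$-presentation (generators $X,J(X)$, $X\in\mathfrak g$), and let $\rho:Y(\mathfrak g)\to\mathrm{End}\,V$ be a finite-dimensional module which contains a non-trivial irreducible submodule. Fix a basis of $V$, with matrix units $E_{ij}$ ($1\le i,j\le N$), and a basis $\{X_\lambda^\bullet\}_{\lambda\in\mathcal I}$ of $\mathrm{End}_{Y(\mathfrak g)}V$. Put $$\Omega_\rho=\sum_{\lambda\in\Lambda}\rho(X_\lambda)\otimes\rho(X_\lambda),\quad (1\otimes J)(\Omega_\rho)=\sum_{\lambda\in\Lambda}\rho(X_\lambda)\otimes\rho(J(X_\lambda)),\quad (J\otimes 1)(\Omega_\rho)=\sum_{\lambda\in\Lambda}\rho(J(X_\lambda))\otimes\rho(X_\lambda).$$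 For a matrix $F=\sum_{i,j}E_{ij}\otimes F_{ij}$ over a $\mathbb C$-algebra $A$ let $F_1=\sum E_{ij}\otimes1\otimes F_{ij}$, $F_2=\sum 1\otimes E_{ij}\otimes F_{ij}$ in $(\mathrm{End}\,V)^{\otimes2}\otimes A$, and $\omega(F)=\sum_{i,j}\sum_{\lambda\in\Lambda}[\rho(X_\lambda),[\rho(X_\lambda),E_{ij}]]\otimes F_{ij}$. Let $U_\rho(\mathfrak g)$ be the unital associative algebra generated by $F_{ij}$ subject to $[F_1,F_2]=[\Omega_\rho,F_2]$ and $F=c_{\mathfrak g}^{-1}\omega(F)$. Let $U_{\mathcal I}(\mathfrak g)$ be the unital associative algebra generated by $F_{ij}^{\mathcal I}$ subject to $[F_1^{\mathcal I},F_2^{\mathcal I}]=[\Omega_\rho,F_2^{\mathcal I}]$ and $[K_2^{\mathcal I},(1\otimes J)(\Omega_\rho)]=[K_1^{\mathcal I},(J\otimes1)(\Omega_\rho)]$, where $K^{\mathcal I}=F^{\mathcal I}-c_{\mathfrak g}^{-1}\omega(F^{\mathcal I})$. Let $\mathfrak g_{\mathcal I}$ be the Lie subalgebra of $U_{\mathcal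 I}(\mathfrak g)$ (with the commutator bracket) generated by the $F_{ij}^{\mathcal I}$, let $\mathfrak z_{\mathcal I}$ be the commutative Lie algebra with basis $\{\mathcal K_\lambda\}_{\lambda\in\mathcal I}$, and put $\mathscr K=\sum_{\lambda\in\mathcal I}X_\lambda^\bullet\otimes\mathcal K_\lambda$. For a Lie algebra $\mathfrak a$ let $\mathfrak a[z]=\mathfrak a\otimes\mathbb C[z]$ be its polynomial current algebra. Then: 1. There are algebra isomorphisms $U_\rho(\mathfrak g)\cong U(\mathfrak g)$, $F\mapsto-(\rho\otimes1)(\Omega)$, and $U_{\mathcal I}(\mathfrak g)\cong\mathbb C[\mathcal K_\lambda:\lambda\in\mathcal I]\otimes U_\rho(\mathfrak g)$, $F^{\mathcal I}\mapsto F+\mathscr K$. 2. There is an isomorphism of Lie algebras $\mathfrak g_{\mathcal I}\cong\mathfrak g\oplus\mathfrak z_{\mathcal I}$, $F^{\mathcal I}\mapsto-(\rho\otimes1)(\Omega)+\mathscr K$; the inclusion $\mathfrak g_{\mathcal I}\subset U_{\mathcal I}(\mathfrak g)$ induces an isomorphism $U(\mathfrak g_{\mathcal I})\cong U_{\mathcal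 I}(\mathfrak g)$; and $\dim\mathfrak z_{\mathcal I}=\dim\mathrm{End}_{Y(\mathfrak g)}V$. 3. There is an algebra isomorphism $U(\mathfrak g_{\mathcal I}[z])\cong U((\mathfrak g\oplus\mathfrak z_{\mathcal I})[z])$ with $F^{\mathcal I}z^r\mapsto-(\rho\otimes1)(\Omega)z^r+\mathscr Kz^r$ for all $r\ge0$. 4. $U(\mathfrak g_{\mathcal I}[z])$ is the unital associative algebra presented by the generators $\mathbb F_{ij}^{(r)}=F_{ij}^{\mathcal I}z^r$ ($1\le i,j\le N$, $r\ge0$) and the relations $$[\mathbb F_1(u),\mathbb F_2(v)]=\Big[\frac{\Omega_\rho}{u-v},\mathbb F_1(u)+\mathbb F_2(v)\Big],\qquad [\mathbb K_2(u),(1\otimes J)(\Omega_\rho)]=[\mathbb K_1(u),(J\otimes1)(\Omega_\rho)],$$ where $\mathbb F(u)=\sum_{r\ge0}\mathbb F^{(r)}u^{-r-1}$, $\mathbb K(u)=\mathbb F(u)-c_{\mathfrak g}^{-1}\omega(\mathbb F(u))$ and $(u-v)^{-1}=\sum_{p\ge0}v^pu^{-p-1}$. 5. For any matrices $\mathbb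 F^{(r)}$, $r\ge0$, over any unital associative $\mathbb C$-algebra, the two relations in 4 are equivalent to $$[\mathbb F_1^{(r)},\mathbb F_2^{(s)}]=[\Omega_\rho,\mathbb F_2^{(r+s)}]\quad\text{and}\quad[\mathbb K_2^{(r)},(1\otimes J)(\Omega_\rho)]=[\mathbb K_1^{(r)},(J\otimes1)(\Omega_\rho)]\quad\text{for all }r,s\ge0,$$ where $\mathbb K^{(r)}=\mathbb F^{(r)}-c_{\mathfrak g}^{-1}\omega(\mathbb F^{(r)})$. -/

import Mathlib

open scoped TensorProduct Kronecker Polynomial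

attribute [local instance 100] LieRing.ofAssociativeRing

noncomputable section

namespace ExtCurrent

/-! ### The Yangian in its `J`-presentation -/

/-- Generators of the Yangian: the elements `x` and `J(x)` for `x` in the Lie algebra. -/
inductive YGen (𝔤 : Type*) : Type _
  | el (x : 𝔤) : YGen 𝔤
  | J (x : 𝔤) : YGen 𝔤

/-- The symmetrizer `{x₁,x₂,x₃} = (1/24) ∑_π x_{π(1)} x_{π(2)} x_{π(3)}`. -/
def symm3 {A : Type*} [Ring A] [Algebra ℂ A] (x : Fin 3 → A) : A :=
  (1 / 24 : ℂ) • ∑ π : Equiv.Perm (Fin 3), x (π 0) * x (π 1) * x (π 2)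

section Yangian

variable {𝔤 : Type*} [LieRing 𝔤] [LieAlgebra ℂ 𝔤] {Λ : Type*} [Fintype Λ]

/-- The free generator `x`. -/
def fEl (x : 𝔤) : FreeAlgebra ℂ (YGen 𝔤) := FreeAlgebra.ι ℂ (YGen.el x)

/-- The free generator `J(x)`. -/
def fJ (x : 𝔤) : FreeAlgebra ℂ (YGen 𝔤) := FreeAlgebra.ι ℂ (YGen.J x)

/-- Defining relations of the Yangian, with respect to the form `B` and a basis `X` of the
Lie algebra which is orthonormal for `B`. -/
inductive YRel (B : LinearMap.BilinForm ℂ 𝔤) (X : Λ → 𝔤) :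
    FreeAlgebra ℂ (YGen 𝔤) → FreeAlgebra ℂ (YGen 𝔤) → Prop
  | el_lin (c d : ℂ) (x y : 𝔤) : YRel B X (fEl (c • x + d • y)) (c • fEl x + d • fEl y)
  | el_lie (x y : 𝔤) : YRel B X (fEl x * fEl y - fEl y * fEl x) (fEl ⁅x, y⁆)
  | J_lie (x y : 𝔤) : YRel B X (fJ ⁅x, y⁆) ⁅fJ x, fEl y⁆
  | J_lin (c d : ℂ) (x y : 𝔤) : YRel B X (fJ (c • x + d • y)) (c • fJ x + d • fJ y)
  | cubic (x y z : 𝔤) : YRel B X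
      (⁅fJ x, ⁅fJ y, fEl z⁆⁆ - ⁅fEl x, ⁅fJ y, fJ z⁆⁆)
      (∑ l : Λ, ∑ m : Λ, ∑ n : Λ,
        B ⁅x, X l⁆ ⁅⁅y, X m⁆, ⁅z, X n⁆⁆ • symm3 ![fEl (X l), fEl (X m), fEl (X n)])
  | quartic (x y z w : 𝔤) : YRel B X
      (⁅⁅fJ x, fJ y⁆, ⁅fEl z, fJ w⁆⁆ + ⁅⁅fJ z, fJ w⁆, ⁅fEl x, fJ y⁆⁆)
      (∑ l : Λ, ∑ m : Λ, ∑ n : Λ,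
        (B ⁅x, X l⁆ ⁅⁅y, X m⁆, ⁅⁅z, w⁆, X n⁆⁆ + B ⁅z, X l⁆ ⁅⁅w, X m⁆, ⁅⁅x, y⁆, X n⁆⁆) •
          symm3 ![fEl (X l), fEl (X m), fJ (X n)])

/-- The Yangian `Y(𝔤)`. -/
def Yangian (B : LinearMap.BilinForm ℂ 𝔤) (X : Λ → 𝔤) : Type _ := RingQuot (YRel B X)

instance (B : LinearMap.BilinForm ℂ 𝔤) (X : Λ → 𝔤) : Ring (Yangian B X) :=
  inferInstanceAs (Ring (RingQuot (YRel B X)))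

instance (B : LinearMap.BilinForm ℂ 𝔤) (X : Λ → 𝔤) : Algebra ℂ (Yangian B X) :=
  inferInstanceAs (Algebra ℂ (RingQuot (YRel B X)))

/-- The image of `x` in the Yangian. -/
def Yangian.el (B : LinearMap.BilinForm ℂ 𝔤) (X : Λ → 𝔤) (x : 𝔤) : Yangian B X :=
  RingQuot.mkAlgHom ℂ (YRel B X) (fEl x)

/-- The element `J(x)` of the Yangian. -/
def Yangian.J (B : LinearMap.BilinForm ℂ 𝔤) (X : Λ → 𝔤) (x : 𝔤) : Yangian B X :=
  RingQuot.mkAlgHom ℂ (YRel B X) (fJ x)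

variable {B : LinearMap.BilinForm ℂ 𝔤} {X : Λ → 𝔤} {V : Type*} [AddCommGroup V] [Module ℂ V]

/-- `W` is a submodule of the `Y(𝔤)`-module given by `ρ`. -/
def IsYSubmodule (ρ : Yangian B X →ₐ[ℂ] Module.End ℂ V) (W : Submodule ℂ V) : Prop :=
  ∀ y : Yangian B X, ∀ w ∈ W, ρ y w ∈ W

/-- The `Y(𝔤)`-module given by `ρ` has an irreducible submodule which is not the trivial
module (the one on which all `x` and all `J(x)` act by zero). -/
def HasNontrivialIrreducibleSubmodule (ρ : Yangian B X →ₐ[ℂ] Module.End ℂ V) : Prop :=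
  ∃ W : Submodule ℂ V, IsYSubmodule ρ W ∧ W ≠ ⊥ ∧
    (∀ W' ≤ W, IsYSubmodule ρ W' → W' = ⊥ ∨ W' = W) ∧
    ∃ x : 𝔤, ∃ w ∈ W, ρ (Yangian.el B X x) w ≠ 0 ∨ ρ (Yangian.J B X x) w ≠ 0

/-- The space `End_{Y(𝔤)} V` of endomorphisms of the `Y(𝔤)`-module given by `ρ`. -/
def endY (ρ : Yangian B X →ₐ[ℂ] Module.End ℂ V) : Submodule ℂ (Module.End ℂ V) :=
  Subalgebra.toSubmodule (Subalgebra.centralizer ℂ (Set.range ρ))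

/-- The action of the Casimir element `ω = ∑ X_λ²` in the adjoint representation. -/
def adCasimir (X : Λ → 𝔤) : Module.End ℂ 𝔤 :=
  ∑ l : Λ, LieAlgebra.ad ℂ 𝔤 (X l) * LieAlgebra.ad ℂ 𝔤 (X l)

end Yangian

/-! ### Matrix notation

`Matrix ι ι A` stands for `End V ⊗ A`, and `Matrix (ι × ι) (ι × ι) A` for
`End V ⊗ End V ⊗ A`, through a fixed basis of `V` indexed by `ι`. -/

section MatrixNotation

variable {Λ ι : Type*} [Fintype Λ] [Fintype ι] [DecidableEq ι]
variable {A : Type*} [Ring A] [Algebra ℂ A]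

/-- `F₁ = ∑ E_ij ⊗ 1 ⊗ F_ij`. -/
def mat₁ (F : Matrix ι ι A) : Matrix (ι × ι) (ι × ι) A := F ⊗ₖ (1 : Matrix ι ι A)

/-- `F₂ = ∑ 1 ⊗ E_ij ⊗ F_ij`. -/
def mat₂ (F : Matrix ι ι A) : Matrix (ι × ι) (ι × ι) A := (1 : Matrix ι ι A) ⊗ₖ F

/-- A complex matrix `M`, identified with `M ⊗ 1`. -/
def scal (A : Type*) [Ring A] [Algebra ℂ A] {n : Type*} (M : Matrix n n ℂ) : Matrix n n A :=
  M.map (algebraMap ℂ A)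

/-- `∑_λ P_λ ⊗ Q_λ`. When `P_λ = ρ(X_λ)` and `Q_λ = ρ(J(X_λ))`, one obtains
`Ω_ρ = tens P P`, `(1 ⊗ J)(Ω_ρ) = tens P Q` and `(J ⊗ 1)(Ω_ρ) = tens Q P`. -/
def tens (P Q : Λ → Matrix ι ι ℂ) : Matrix (ι × ι) (ι × ι) ℂ := ∑ l : Λ, P l ⊗ₖ Q l

/-- `ω(F) = ∑ ω(E_ij) ⊗ F_ij`, where `ω(E_ij) = ∑_λ [ρ(X_λ), [ρ(X_λ), E_ij]]`. -/
def omegaMat (P : Λ → Matrix ι ι ℂ) (F : Matrix ι ι A) : Matrix ι ι A :=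
  ∑ l : Λ, ⁅scal A (P l), ⁅scal A (P l), F⁆⁆

/-- `K = F - c⁻¹ ω(F)`. -/
def kMat (P : Λ → Matrix ι ι ℂ) (c : ℂ) (F : Matrix ι ι A) : Matrix ι ι A :=
  F - c⁻¹ • omegaMat P F

/-! The two sides of the relations in formal series. The variable of a power series over `A`
is `u⁻¹`. Series in two variables live in `A((v⁻¹))[[u⁻¹]]`: power series in `u⁻¹` whose
coefficients are Laurent series in `v⁻¹`. -/

/-- `F_ij(u) = ∑_{r ≥ 0} F_ij^{(r)} u^{-r-1}`. -/
def serMat (F : ℕ → Matrix ι ι A) : Matrix ι ι (PowerSeries A) :=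
  Matrix.of fun i j => PowerSeries.mk fun n => Nat.casesOn n 0 fun r => F r i j

/-- `F(u)` as a matrix over `A((v⁻¹))[[u⁻¹]]`. -/
def serU (F : ℕ → Matrix ι ι A) : Matrix ι ι (PowerSeries (LaurentSeries A)) :=
  (serMat F).map (PowerSeries.map HahnSeries.C)

/-- `F(v)` as a matrix over `A((v⁻¹))[[u⁻¹]]`. -/
def serV (F : ℕ → Matrix ι ι A) : Matrix ι ι (PowerSeries (LaurentSeries A)) :=
  (serMat F).map fun f => PowerSeries.C (HahnSeries.ofPowerSeries ℤ A f)

/-- `(u - v)⁻¹ = ∑_{p ≥ 0} v^p u^{-p-1}`. -/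
def invUV (A : Type*) [Ring A] : PowerSeries (LaurentSeries A) :=
  PowerSeries.mk fun n => Nat.casesOn n 0 fun p => HahnSeries.single (-(p : ℤ)) 1

/-- Sanity check: `(1 - v u⁻¹) (u - v)⁻¹ = u⁻¹`. -/
theorem one_sub_mul_invUV (A : Type*) [Ring A] :
    (1 - PowerSeries.C (HahnSeries.single (-1 : ℤ) (1 : A)) * PowerSeries.X) * invUV A
      = PowerSeries.X := by
  ext1 n
  rw [sub_mul, one_mul, mul_assoc, map_sub, PowerSeries.coeff_C_mul]
  rcases n with _ | _ | n
  · simp [invUV]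
  · rw [PowerSeries.coeff_succ_X_mul]
    simp [invUV]
  · rw [PowerSeries.coeff_succ_X_mul, PowerSeries.coeff_X]
    simp [invUV, HahnSeries.single_mul_single]

/-- `[F₁(u), F₂(v)]`. -/
def rLeft (F : ℕ → Matrix ι ι A) :
    Matrix (ι × ι) (ι × ι) (PowerSeries (LaurentSeries A)) :=
  ⁅mat₁ (serU F), mat₂ (serV F)⁆

/-- `[Ω_ρ / (u - v), F₁(u) + F₂(v)]`. -/
def rRight (P : Λ → Matrix ι ι ℂ) (F : ℕ → Matrix ι ι A) :
    Matrix (ι × ι) (ι × ι) (PowerSeries (LaurentSeries A)) :=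
  ⁅invUV A • scal (PowerSeries (LaurentSeries A)) (tens P P), mat₁ (serU F) + mat₂ (serV F)⁆

/-- `[K₂(u), (1 ⊗ J)(Ω_ρ)]`, where `K(u) = F(u) - c⁻¹ ω(F(u))`. -/
def kLeft (P Q : Λ → Matrix ι ι ℂ) (c : ℂ) (F : ℕ → Matrix ι ι A) :
    Matrix (ι × ι) (ι × ι) (PowerSeries A) :=
  ⁅mat₂ (kMat P c (serMat F)), scal (PowerSeries A) (tens P Q)⁆

/-- `[K₁(u), (J ⊗ 1)(Ω_ρ)]`, where `K(u) = F(u) - c⁻¹ ω(F(u))`. -/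
def kRight (P Q : Λ → Matrix ι ι ℂ) (c : ℂ) (F : ℕ → Matrix ι ι A) :
    Matrix (ι × ι) (ι × ι) (PowerSeries A) :=
  ⁅mat₁ (kMat P c (serMat F)), scal (PowerSeries A) (tens Q P)⁆

end MatrixNotation

/-! ### The algebras defined by generators and relations -/

section Presented

variable {Λ ι : Type*} [Fintype Λ] [Fintype ι] [DecidableEq ι]

/-- The matrix of free generators. -/
def freeMat (ι : Type*) : Matrix ι ι (FreeAlgebra ℂ (ι × ι)) :=
  Matrix.of fun i j => FreeAlgebra.ι ℂ (i, j)

/-- Relations of `U_ρ(𝔤)`: `[F₁, F₂] = [Ω_ρ, F₂]` and `F = c⁻¹ ω(F)`. -/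
inductive URhoRel (P : Λ → Matrix ι ι ℂ) (c : ℂ) :
    FreeAlgebra ℂ (ι × ι) → FreeAlgebra ℂ (ι × ι) → Prop
  | bracket (p q : ι × ι) : URhoRel P c
      (⁅mat₁ (freeMat ι), mat₂ (freeMat ι)⁆ p q)
      (⁅scal (FreeAlgebra ℂ (ι × ι)) (tens P P), mat₂ (freeMat ι)⁆ p q)
  | casimir (i j : ι) : URhoRel P c (freeMat ι i j) ((c⁻¹ • omegaMat P (freeMat ι)) i j)

/-- The algebra `U_ρ(𝔤) = U(𝔤_ρ)`. -/
def URho (P : Λ → Matrix ι ι ℂ) (c : ℂ) : Type _ := RingQuot (URhoRel P c)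

instance (P : Λ → Matrix ι ι ℂ) (c : ℂ) : Ring (URho P c) :=
  inferInstanceAs (Ring (RingQuot (URhoRel P c)))

instance (P : Λ → Matrix ι ι ℂ) (c : ℂ) : Algebra ℂ (URho P c) :=
  inferInstanceAs (Algebra ℂ (RingQuot (URhoRel P c)))

/-- The generator `F_ij` of `U_ρ(𝔤)`. -/
def URho.F (P : Λ → Matrix ι ι ℂ) (c : ℂ) (i j : ι) : URho P c :=
  RingQuot.mkAlgHom ℂ (URhoRel P c) (freeMat ι i j)

/-- Relations of `U_I(𝔤)`: `[F₁, F₂] = [Ω_ρ, F₂]` and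
`[K₂, (1 ⊗ J)(Ω_ρ)] = [K₁, (J ⊗ 1)(Ω_ρ)]`, where `K = F - c⁻¹ ω(F)`. -/
inductive UIRel (P Q : Λ → Matrix ι ι ℂ) (c : ℂ) :
    FreeAlgebra ℂ (ι × ι) → FreeAlgebra ℂ (ι × ι) → Prop
  | bracket (p q : ι × ι) : UIRel P Q c
      (⁅mat₁ (freeMat ι), mat₂ (freeMat ι)⁆ p q)
      (⁅scal (FreeAlgebra ℂ (ι × ι)) (tens P P), mat₂ (freeMat ι)⁆ p q)
  | k (p q : ι × ι) : UIRel P Q c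
      (⁅mat₂ (kMat P c (freeMat ι)), scal (FreeAlgebra ℂ (ι × ι)) (tens P Q)⁆ p q)
      (⁅mat₁ (kMat P c (freeMat ι)), scal (FreeAlgebra ℂ (ι × ι)) (tens Q P)⁆ p q)

/-- The extended enveloping algebra `U_I(𝔤)`. -/
def UI (P Q : Λ → Matrix ι ι ℂ) (c : ℂ) : Type _ := RingQuot (UIRel P Q c)

instance (P Q : Λ → Matrix ι ι ℂ) (c : ℂ) : Ring (UI P Q c) :=
  inferInstanceAs (Ring (RingQuot (UIRel P Q c)))

instance (P Q : Λ → Matrix ι ι ℂ) (c : ℂ) : Algebra ℂ (UI P Q c) :=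
  inferInstanceAs (Algebra ℂ (RingQuot (UIRel P Q c)))

/-- The generator `F_ij` of `U_I(𝔤)`. -/
def UI.F (P Q : Λ → Matrix ι ι ℂ) (c : ℂ) (i j : ι) : UI P Q c :=
  RingQuot.mkAlgHom ℂ (UIRel P Q c) (freeMat ι i j)

/-- The Lie algebra `𝔤_I`: the Lie subalgebra of `Lie(U_I(𝔤))` generated by the `F_ij`. -/
def gI (P Q : Λ → Matrix ι ι ℂ) (c : ℂ) : LieSubalgebra ℂ (UI P Q c) :=
  LieSubalgebra.lieSpan ℂ (UI P Q c) (Set.range fun p : ι × ι => UI.F P Q c p.1 p.2)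

/-- The generator `F_ij` as an element of `𝔤_I`. -/
def gI.F (P Q : Λ → Matrix ι ι ℂ) (c : ℂ) (i j : ι) : gI P Q c :=
  ⟨UI.F P Q c i j, LieSubalgebra.subset_lieSpan ⟨(i, j), rfl⟩⟩

/-- The matrices `F^{(r)}` of free generators `F_ij^{(r)}`, `r ≥ 0`. -/
def freeSeq (ι : Type*) (r : ℕ) : Matrix ι ι (FreeAlgebra ℂ (ι × ι × ℕ)) :=
  Matrix.of fun i j => FreeAlgebra.ι ℂ (i, j, r)

/-- The `r`-matrix relations: all coefficients of
`[F₁(u), F₂(v)] = [Ω_ρ / (u - v), F₁(u) + F₂(v)]` and of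
`[K₂(u), (1 ⊗ J)(Ω_ρ)] = [K₁(u), (J ⊗ 1)(Ω_ρ)]`. -/
inductive RMatRel (P Q : Λ → Matrix ι ι ℂ) (c : ℂ) :
    FreeAlgebra ℂ (ι × ι × ℕ) → FreeAlgebra ℂ (ι × ι × ℕ) → Prop
  | r (p q : ι × ι) (n : ℕ) (m : ℤ) : RMatRel P Q c
      ((PowerSeries.coeff n (rLeft (freeSeq ι) p q)).coeff m)
      ((PowerSeries.coeff n (rRight P (freeSeq ι) p q)).coeff m)
  | k (p q : ι × ι) (n : ℕ) : RMatRel P Q c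
      (PowerSeries.coeff n (kLeft P Q c (freeSeq ι) p q))
      (PowerSeries.coeff n (kRight P Q c (freeSeq ι) p q))

/-- The algebra with generators `F_ij^{(r)}` presented by the `r`-matrix relations. -/
def RMatAlg (P Q : Λ → Matrix ι ι ℂ) (c : ℂ) : Type _ := RingQuot (RMatRel P Q c)

instance (P Q : Λ → Matrix ι ι ℂ) (c : ℂ) : Ring (RMatAlg P Q c) :=
  inferInstanceAs (Ring (RingQuot (RMatRel P Q c)))

instance (P Q : Λ → Matrix ι ι ℂ) (c : ℂ) : Algebra ℂ (RMatAlg P Q c) :=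
  inferInstanceAs (Algebra ℂ (RingQuot (RMatRel P Q c)))

/-- The generator `F_ij^{(r)}`. -/
def RMatAlg.F (P Q : Λ → Matrix ι ι ℂ) (c : ℂ) (r : ℕ) (i j : ι) : RMatAlg P Q c :=
  RingQuot.mkAlgHom ℂ (RMatRel P Q c) (freeSeq ι r i j)

end Presented

/-! ### Commutative Lie algebras and polynomial current algebras -/

/-- The commutative Lie algebra with a basis indexed by `I`. -/
def AbelianLie (I : Type*) : Type _ := I →₀ ℂ

instance (I : Type*) : AddCommGroup (AbelianLie I) := inferInstanceAs (AddCommGroup (I →₀ ℂ))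

instance (I : Type*) : Module ℂ (AbelianLie I) := inferInstanceAs (Module ℂ (I →₀ ℂ))

instance (I : Type*) : LieRing (AbelianLie I) where
  bracket _ _ := 0
  add_lie _ _ _ := (add_zero 0).symm
  lie_add _ _ _ := (add_zero 0).symm
  lie_self _ := rfl
  leibniz_lie _ _ _ := (add_zero 0).symm

instance (I : Type*) : LieAlgebra ℂ (AbelianLie I) where
  lie_smul t _ _ := (smul_zero t).symm

/-- The basis element `𝒦_l`. -/
def AbelianLie.K {I : Type*} (l : I) : AbelianLie I := (Finsupp.single l 1 : I →₀ ℂ)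

/-- The polynomial current algebra `𝔞[z]`, with `[f ⊗ x, g ⊗ y] = f g ⊗ [x, y]`. -/
abbrev Current (𝔞 : Type*) [LieRing 𝔞] [LieAlgebra ℂ 𝔞] : Type _ := ℂ[X] ⊗[ℂ] 𝔞

/-- The element `x z^r` of `𝔞[z]`. -/
def cur {𝔞 : Type*} [LieRing 𝔞] [LieAlgebra ℂ 𝔞] (r : ℕ) (x : 𝔞) : Current 𝔞 :=
  ((Polynomial.X : ℂ[X]) ^ r) ⊗ₜ[ℂ] x

/-- The element `x z^r` of `U(𝔞[z])`. -/
def ucur {𝔞 : Type*} [LieRing 𝔞] [LieAlgebra ℂ 𝔞] (r : ℕ) (x : 𝔞) :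
    UniversalEnvelopingAlgebra ℂ (Current 𝔞) :=
  UniversalEnvelopingAlgebra.ι ℂ (cur r x)

end ExtCurrent

end

open ExtCurrent

/-!
Write `L = 𝔤 ⊕ 𝔷_I`. All the algebras in the theorem are shown to have the same universal property
as the enveloping algebra of `L` (or of `𝔤`, or of `L[z]`), so that the isomorphisms are obtained
from homomorphisms which are inverse to each other on generators; no basis of an algebra given by a
presentation is ever needed.

The main point is that the matrices `F^{(r)}` over an algebra `A` which satisfy the relations on the
modes are the same as families of linear maps `H_r : L → A` with `[H_r x, H_s y] = H_{r+s}[x, y]`,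
in other words homomorphisms `L[z] → A` of Lie algebras, through
`F^{(r)} = -∑ ρ(X_l) ⊗ H_r(X_l) + ∑ S_l ⊗ H_r(𝒦_l)`; see `IsMatrixRep.modeRel_of_isCurrentRep` and
`IsMatrixRep.exists_isCurrentRep`. Constant families give the case of homomorphisms `L → A`.

To find `H_r` from `F^{(r)}`, compare the relation for the modes `(r, 0)` with the one for `(0, r)`.
By antisymmetry of the bracket, `[Ω_ρ, F_2]` changes sign when the tensor factors are exchanged, and
since the `ρ(X_l)` are linearly independent, all `[ρ(X_l), F]` lie in `ρ(𝔤) ⊗ A`. The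
Casimir operator acts there by `c`, which is not zero (`casimir_eigenvalue_ne_zero`), so that
`c⁻¹ ω(F)` lies in `ρ(𝔤) ⊗ A` and `K = F - c⁻¹ ω(F)` commutes with `ρ(𝔤)`
(`IsMatrixRep.exists_decomposition`). The second relation then makes `K` commute with all
`ρ(J(x))`: applying functionals on `A`, one may take a complex matrix `K`. The relation gives
`[ρ(J(x)), K] = ρ(T x)` for an endomorphism `T` commuting with the adjoint action, hence
`[ρ(J(x)), K] = a ρ(x)` for a scalar `a`, by Schur's lemma; and `a = 0` because the trace form
of `ρ` is not zero (`IsMatrixRep.lie_q_eq_zero`). So `K` lies in `End_{Y(𝔤)} V ⊗ A`.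

That `ρ` is faithful on `𝔤`, which all of this uses, follows from the existence of a non-trivial
submodule: if `𝔤` acts by zero, so does `J(𝔤)`, because `J([x, y]) = [J(x), y]`
(`injective_of_hasNontrivialIrreducibleSubmodule`).

To identify `𝔤_I` with `L` inside `U_I(𝔤) ≅ U(L)`, one needs only that `L → U(L)` is injective.
For this `L` the adjoint representation of `𝔤` and the polynomials in the `𝒦_l` suffice
(`ι_prod_abelianLie_injective`).

Finally, in the relation in formal series, the coefficients of `u^{-r-1} v^{-s-1}` with
`r, s ≥ 0` are the relations on the modes, and the remaining ones are trivial or say that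
`[Ω_ρ, F_1 + F_2] = 0` for a mode `F` (`modeRel_iff`).
-/

namespace ExtCurrent

/-! ### The Casimir operator of a simple Lie algebra -/

section SimpleLie

variable {𝔤 : Type*} [LieRing 𝔤] [LieAlgebra ℂ 𝔤] [LieAlgebra.IsSimple ℂ 𝔤]

/-- Schur's lemma for the adjoint representation. -/
theorem eq_smul_of_lie_equivariant [FiniteDimensional ℂ 𝔤] (f : 𝔤 →ₗ[ℂ] 𝔤)
    (hf : ∀ x y : 𝔤, f ⁅x, y⁆ = ⁅x, f y⁆) {a : ℂ} (ha : Module.End.HasEigenvalue f a) (x : 𝔤) :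
    f x = a • x := by
  let J : LieIdeal ℂ 𝔤 :=
    { Module.End.eigenspace f a with
      lie_mem := by
        intro x m hm
        have hm' : f m = a • m := Module.End.mem_eigenspace_iff.mp hm
        exact Module.End.mem_eigenspace_iff.mpr (by rw [hf, hm', lie_smul]) }
  have hmem : ∀ y, y ∈ J ↔ f y = a • y := fun y => Module.End.mem_eigenspace_iff
  rcases LieAlgebra.IsSimple.eq_bot_or_eq_top (R := ℂ) J with h | h
  · obtain ⟨v, hv, hv0⟩ := ha.exists_hasEigenvector
    have : v ∈ J := hv
    rw [h] at this
    exact absurd this hv0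
  · exact (hmem x).mp (h ▸ LieSubmodule.mem_top x)

theorem exists_eq_smul_of_lie_equivariant [FiniteDimensional ℂ 𝔤] (f : 𝔤 →ₗ[ℂ] 𝔤)
    (hf : ∀ x y : 𝔤, f ⁅x, y⁆ = ⁅x, f y⁆) : ∃ a : ℂ, ∀ x, f x = a • x := by
  have : Nontrivial 𝔤 := LieAlgebra.IsSimple.nontrivial (R := ℂ) (L := 𝔤)
  obtain ⟨a, ha⟩ := Module.End.exists_eigenvalue f
  exact ⟨a, eq_smul_of_lie_equivariant f hf ha⟩

theorem lie_top_top_eq_top : ⁅(⊤ : LieIdeal ℂ 𝔤), (⊤ : LieIdeal ℂ 𝔤)⁆ = ⊤ := by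
  rcases LieAlgebra.IsSimple.eq_bot_or_eq_top (R := ℂ)
    ⁅(⊤ : LieIdeal ℂ 𝔤), (⊤ : LieIdeal ℂ 𝔤)⁆ with h | h
  · refine absurd ?_ (LieAlgebra.IsSimple.non_abelian (R := ℂ) (L := 𝔤))
    rw [LieSubmodule.lie_eq_bot_iff] at h
    exact ⟨fun x y => h x trivial y trivial⟩
  · exact h

/-- A linear map on a perfect Lie algebra vanishes if it vanishes on brackets. -/
theorem linearMap_eq_zero_of_lie {M : Type*} [AddCommGroup M] [Module ℂ M] (f : 𝔤 →ₗ[ℂ] M)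
    (hf : ∀ x y : 𝔤, f ⁅x, y⁆ = 0) : f = 0 := by
  ext x
  have hx : x ∈ (⁅(⊤ : LieIdeal ℂ 𝔤), (⊤ : LieIdeal ℂ 𝔤)⁆ : LieIdeal ℂ 𝔤) := by
    rw [lie_top_top_eq_top]; trivial
  rw [← LieSubmodule.mem_toSubmodule, LieSubmodule.lieIdeal_oper_eq_linear_span'] at hx
  induction hx using Submodule.span_induction with
  | mem x h => obtain ⟨y, -, z, -, rfl⟩ := h; simpa using hf y z
  | zero => simp
  | add x y _ _ h1 h2 => simp_all
  | smul a x _ h => simp_all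

theorem not_isSolvable_of_isSimple : ¬ LieAlgebra.IsSolvable 𝔤 := by
  intro h
  have : Nontrivial 𝔤 := LieAlgebra.IsSimple.nontrivial (R := ℂ) (L := 𝔤)
  have h1 : LieAlgebra.radical ℂ 𝔤 = ⊤ := LieAlgebra.radical_eq_top_of_isSolvable ℂ 𝔤
  have h2 : LieAlgebra.radical ℂ 𝔤 = ⊥ := LieAlgebra.HasTrivialRadical.radical_eq_bot
  exact bot_ne_top (h2.symm.trans h1)

/-- The trace form of a faithful representation of a simple Lie algebra is not zero: otherwise
the algebra would act nilpotently by Cartan's criterion, hence be nilpotent. -/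
theorem exists_trace_mul_ne_zero [FiniteDimensional ℂ 𝔤] {ι : Type*} [Fintype ι] [DecidableEq ι]
    (p : 𝔤 →ₗ⁅ℂ⁆ Matrix ι ι ℂ) (hp : Function.Injective p) :
    ∃ x y, (p x * p y).trace ≠ 0 := by
  by_contra! h0
  let T : 𝔤 →ₗ⁅ℂ⁆ Module.End ℂ (ι → ℂ) := (lieEquivMatrix' (R := ℂ) (n := ι)).symm.toLieHom.comp p
  have hT : Function.Injective T := (lieEquivMatrix' (R := ℂ) (n := ι)).symm.injective.comp hp
  have hTp : ∀ x, T x = Matrix.toLin' (p x) := fun x => rfl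
  let _ : LieRingModule 𝔤 (ι → ℂ) := LieRingModule.compLieHom (ι → ℂ) T
  let _ : LieModule ℂ 𝔤 (ι → ℂ) := LieModule.compLieHom (ι → ℂ) T
  have hφ : ∀ x, LieModule.toEnd ℂ 𝔤 (ι → ℂ) x = T x := fun x => rfl
  have htr : LieModule.traceForm ℂ 𝔤 (ι → ℂ) = 0 := by
    ext x y
    rw [LieModule.traceForm_apply_apply, hφ, hφ, hTp, hTp, ← Matrix.toLin'_mul,
      Matrix.trace_toLin'_eq]
    exact h0 x y
  have hnil := LieModule.isNilpotent_derivedSeries_of_traceForm_eq_zero htr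
  have hder : LieAlgebra.derivedSeries ℂ 𝔤 1 = ⊤ := lie_top_top_eq_top
  have hnilp : ∀ x, IsNilpotent (T x) := fun x =>
    LieModule.isNilpotent_iff_forall' (R := ℂ).mp hnil ⟨x, by rw [hder]; trivial⟩
  have : LieRing.IsNilpotent 𝔤 := by
    rw [LieAlgebra.isNilpotent_iff_forall (R := ℂ)]
    intro x
    obtain ⟨n, hn⟩ := LieAlgebra.ad_nilpotent_of_nilpotent (R := ℂ) (hnilp x)
    refine ⟨n, ?_⟩
    ext y
    apply hT
    have key : ∀ k y, T (((LieAlgebra.ad ℂ 𝔤 x) ^ k) y)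
        = ((LieAlgebra.ad ℂ _ (T x)) ^ k) (T y) := by
      intro k
      induction k with
      | zero => simp
      | succ k ih => intro y; rw [pow_succ, pow_succ, Module.End.mul_apply, ih]; simp
    rw [key, hn]; simp
  exact not_isSolvable_of_isSimple (𝔤 := 𝔤) inferInstance

end SimpleLie

section Casimir

variable {𝔤 : Type*} [LieRing 𝔤] [LieAlgebra ℂ 𝔤]
  {B : LinearMap.BilinForm ℂ 𝔤} {Λ : Type*} [Fintype Λ] {X : Module.Basis Λ ℂ 𝔤}

theorem adCasimir_apply (x : 𝔤) : adCasimir X x = ∑ l, ⁅X l, ⁅X l, x⁆⁆ := by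
  simp [adCasimir, LinearMap.sum_apply]

variable [DecidableEq Λ]

theorem repr_eq_form (hX : ∀ l m, B (X l) (X m) = if l = m then 1 else 0) (x : 𝔤) (l : Λ) :
    X.repr x l = B x (X l) := by
  have h : B (∑ m, X.repr x m • X m) (X l) = X.repr x l := by
    simp only [map_sum, map_smul, LinearMap.sum_apply, LinearMap.smul_apply, hX, smul_eq_mul,
      mul_ite, mul_one, mul_zero, Finset.sum_ite_eq', Finset.mem_univ, if_true]
  rw [← h, X.sum_repr]

/-- The tensor `∑ X_l ⊗ X_l` is invariant. -/
theorem sum_lie_left_add_sum_lie_right (hBinv : ∀ x y z, B ⁅x, y⁆ z = B x ⁅y, z⁆)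
    (hBsymm : ∀ x y, B x y = B y x)
    (hX : ∀ l m, B (X l) (X m) = if l = m then 1 else 0)
    {M : Type*} [AddCommGroup M] [Module ℂ M] (β : 𝔤 →ₗ[ℂ] 𝔤 →ₗ[ℂ] M) (x : 𝔤) :
    ∑ l, β ⁅x, X l⁆ (X l) + ∑ l, β (X l) ⁅x, X l⁆ = 0 := by
  have h1 : ∀ l, ⁅x, X l⁆ = ∑ m, B ⁅x, X l⁆ (X m) • X m := fun l => by
    conv_lhs => rw [← X.sum_repr ⁅x, X l⁆]
    simp only [repr_eq_form hX]
  have h2 : ∀ l m, B ⁅x, X l⁆ (X m) = - B ⁅x, X m⁆ (X l) := fun l m => by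
    rw [← lie_skew, map_neg, LinearMap.neg_apply, hBinv, hBsymm]
  have h3 : ∑ l, β ⁅x, X l⁆ (X l) = ∑ l, ∑ m, B ⁅x, X l⁆ (X m) • β (X m) (X l) := by
    refine Finset.sum_congr rfl fun l _ => ?_
    conv_lhs => rw [h1 l]
    simp
  have h4 : ∑ l, β (X l) ⁅x, X l⁆ = ∑ l, ∑ m, B ⁅x, X l⁆ (X m) • β (X l) (X m) := by
    refine Finset.sum_congr rfl fun l _ => ?_
    conv_lhs => rw [h1 l]
    simp
  rw [h3, h4, Finset.sum_comm, ← Finset.sum_add_distrib]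
  refine Finset.sum_eq_zero fun l _ => ?_
  rw [← Finset.sum_add_distrib]
  refine Finset.sum_eq_zero fun m _ => ?_
  rw [h2 m l, neg_smul, neg_add_cancel]

/-- The Casimir operator of a representation in a Lie algebra commutes with the action. -/
theorem lie_casimir_comm (hBinv : ∀ x y z, B ⁅x, y⁆ z = B x ⁅y, z⁆)
    (hBsymm : ∀ x y, B x y = B y x)
    (hX : ∀ l m, B (X l) (X m) = if l = m then 1 else 0)
    {L : Type*} [LieRing L] [LieAlgebra ℂ L] (π : 𝔤 →ₗ⁅ℂ⁆ L) (x : 𝔤) (F : L) :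
    ⁅π x, ∑ l, ⁅π (X l), ⁅π (X l), F⁆⁆⁆ = ∑ l, ⁅π (X l), ⁅π (X l), ⁅π x, F⁆⁆⁆ := by
  let β : 𝔤 →ₗ[ℂ] 𝔤 →ₗ[ℂ] L := LinearMap.mk₂ ℂ (fun u v => ⁅π u, ⁅π v, F⁆⁆)
    (by simp) (by simp) (by simp) (by simp)
  have h := sum_lie_left_add_sum_lie_right hBinv hBsymm hX β x
  simp only [β, LinearMap.mk₂_apply] at h
  rw [lie_sum, ← sub_eq_zero, ← Finset.sum_sub_distrib, ← h, ← Finset.sum_add_distrib]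
  refine Finset.sum_congr rfl fun l _ => ?_
  rw [leibniz_lie (π x) (π (X l)), leibniz_lie (π x) (π (X l)) F, lie_add]
  simp only [LieHom.map_lie]
  abel

variable [LieAlgebra.IsSimple ℂ 𝔤]

theorem adCasimir_eq_smul (hBinv : ∀ x y z, B ⁅x, y⁆ z = B x ⁅y, z⁆)
    (hBsymm : ∀ x y, B x y = B y x)
    (hX : ∀ l m, B (X l) (X m) = if l = m then 1 else 0)
    {c : ℂ} (hc : (adCasimir X).HasEigenvalue c) (x : 𝔤) : adCasimir X x = c • x := by
  have : FiniteDimensional ℂ 𝔤 := X.finiteDimensional_of_finite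
  refine eq_smul_of_lie_equivariant _ (fun x y => ?_) hc x
  rw [adCasimir_apply, adCasimir_apply]
  exact (lie_casimir_comm hBinv hBsymm hX (LieHom.id : 𝔤 →ₗ⁅ℂ⁆ 𝔤) x y).symm

/-- The Killing form is a multiple `a B` of the form `B`, with `a ≠ 0` by Cartan's criterion;
comparing traces shows that `c = a`. -/
theorem casimir_eigenvalue_ne_zero (hBinv : ∀ x y z, B ⁅x, y⁆ z = B x ⁅y, z⁆)
    (hBsymm : ∀ x y, B x y = B y x)
    (hX : ∀ l m, B (X l) (X m) = if l = m then 1 else 0)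
    {c : ℂ} (hc : (adCasimir X).HasEigenvalue c) : c ≠ 0 := by
  have : FiniteDimensional ℂ 𝔤 := X.finiteDimensional_of_finite
  have : Nontrivial 𝔤 := LieAlgebra.IsSimple.nontrivial (R := ℂ) (L := 𝔤)
  rintro rfl
  let T : 𝔤 →ₗ[ℂ] 𝔤 := ∑ l, ((killingForm ℂ 𝔤).flip (X l)).smulRight (X l)
  have hT : ∀ x, T x = ∑ l, killingForm ℂ 𝔤 x (X l) • X l := fun x => by
    simp [T, LinearMap.sum_apply]
  have hTB : ∀ x y, B (T x) y = killingForm ℂ 𝔤 x y := fun x y => by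
    conv_rhs => rw [← X.sum_repr y]
    rw [hT]
    simp only [map_sum, map_smul, LinearMap.sum_apply, LinearMap.smul_apply, smul_eq_mul,
      repr_eq_form hX]
    exact Finset.sum_congr rfl fun l _ => by rw [hBsymm y, mul_comm]
  have hBnd : ∀ x, (∀ y, B x y = 0) → x = 0 := fun x h => by
    rw [← X.sum_repr x]
    exact Finset.sum_eq_zero fun l _ => by rw [repr_eq_form hX, h, zero_smul]
  obtain ⟨a, ha⟩ := exists_eq_smul_of_lie_equivariant T fun x y => by
    rw [← sub_eq_zero]
    refine hBnd _ fun z => ?_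
    rw [map_sub, LinearMap.sub_apply, hTB, ← lie_skew, map_neg, LinearMap.neg_apply,
      ← lie_skew x (T y), map_neg, LinearMap.neg_apply, hBinv, hTB,
      LieModule.traceForm_apply_lie_apply, sub_self]
  have hκ : ∀ x y, killingForm ℂ 𝔤 x y = a * B x y := fun x y => by
    rw [← hTB, ha, map_smul, LinearMap.smul_apply, smul_eq_mul]
  have htr : ∑ l, killingForm ℂ 𝔤 (X l) (X l) = 0 := by
    have h0 : adCasimir X = 0 := by
      ext x
      simpa using adCasimir_eq_smul hBinv hBsymm hX hc x
    have := congrArg (LinearMap.trace ℂ 𝔤) h0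
    rw [adCasimir, map_sum, map_zero] at this
    exact this
  have hcard : (Fintype.card Λ : ℂ) ≠ 0 := by
    have : Nonempty Λ := X.index_nonempty
    exact_mod_cast Fintype.card_ne_zero
  have ha0 : a = 0 := by
    simpa [hκ, hX, hcard] using htr
  obtain ⟨x, hx⟩ := exists_ne (0 : 𝔤)
  refine hx ?_
  have hk : x ∈ LinearMap.ker (killingForm ℂ 𝔤) := by
    ext y; simp [hκ, ha0]
  simpa using hk

end Casimir

/-! ### Matrices over an algebra as tensors -/

section Tensors

variable {ι J A A' : Type*} [Fintype J] [Ring A] [Algebra ℂ A] [Ring A'] [Algebra ℂ A']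

/-- The element `M ⊗ a` of `End V ⊗ A`, as a matrix over `A`. -/
noncomputable def tm (A : Type*) [Ring A] [Algebra ℂ A] (ι : Type*) :
    Matrix ι ι ℂ →ₗ[ℂ] A →ₗ[ℂ] Matrix ι ι A :=
  LinearMap.mk₂ ℂ (fun M a => M.map (· • a))
    (fun M N a => by ext; simp [add_smul]) (fun r M a => by ext; simp [mul_smul])
    (fun M a b => by ext; simp) (fun r M a => by ext; simp [smul_comm r])

theorem tm_apply (M : Matrix ι ι ℂ) (a : A) (i j : ι) : tm A ι M a i j = M i j • a := rfl

/-- The matrix `∑ T_l ⊗ k_l` over `A`. -/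
noncomputable def comb (A : Type*) [Ring A] [Algebra ℂ A] {J : Type*} [Fintype J]
    (T : J → Matrix ι ι ℂ) : (J → A) →ₗ[ℂ] Matrix ι ι A :=
  ∑ l, (tm A ι (T l)).comp (LinearMap.proj l)

theorem comb_eq_sum (T : J → Matrix ι ι ℂ) (k : J → A) : comb A T k = ∑ l, tm A ι (T l) (k l) := by
  simp [comb, LinearMap.sum_apply]

theorem comb_apply (T : J → Matrix ι ι ℂ) (k : J → A) (i j : ι) :
    comb A T k i j = ∑ l, T l i j • k l := by
  simp [comb_eq_sum, Matrix.sum_apply, tm_apply]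

variable [Fintype ι]

/-- The map `∑ E_ij ⊗ F_ij ↦ ∑ d_ij F_ij`: the functional on `End V` with coefficients `d_ij`,
applied to the first factor of `End V ⊗ A`. -/
noncomputable def pair (A : Type*) [Ring A] [Algebra ℂ A] (d : Matrix ι ι ℂ) :
    Matrix ι ι A →ₗ[ℂ] A where
  toFun F := ∑ i, ∑ j, d i j • F i j
  map_add' F G := by simp [Finset.sum_add_distrib]
  map_smul' a F := by simp [Finset.smul_sum, smul_comm a]

theorem pair_apply (d : Matrix ι ι ℂ) (F : Matrix ι ι A) :
    pair A d F = ∑ i, ∑ j, d i j • F i j := rfl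

theorem pair_tm (d M : Matrix ι ι ℂ) (a : A) : pair A d (tm A ι M a) = pair ℂ d M • a := by
  simp [pair_apply, tm_apply, Finset.sum_smul, smul_smul]

theorem pair_map (D : A →ₗ[ℂ] A') (d : Matrix ι ι ℂ) (F : Matrix ι ι A) :
    pair A' d (F.map D) = D (pair A d F) := by
  simp [pair_apply]

/-- Linearly independent matrices have a dual family with respect to `pair`. -/
theorem exists_dual_family [DecidableEq ι] [DecidableEq J] {T : J → Matrix ι ι ℂ}
    (hT : LinearIndependent ℂ T) :
    ∃ d : J → Matrix ι ι ℂ, ∀ a b, pair ℂ (d a) (T b) = if a = b then 1 else 0 := by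
  obtain ⟨g, hg⟩ := (Fintype.linearCombination ℂ T).exists_leftInverse_of_injective
    (by rw [LinearMap.ker_eq_bot]; exact hT.fintypeLinearCombination_injective)
  refine ⟨fun a => Matrix.of fun i j => g (Matrix.single i j 1) a, fun a b => ?_⟩
  have h1 : T b = Fintype.linearCombination ℂ T (Pi.single b 1) := by simp
  have h2 : ∀ M, pair ℂ (Matrix.of fun i j => g (Matrix.single i j 1) a) M = g M a := fun M => by
    conv_rhs => rw [Matrix.matrix_eq_sum_single M]
    simp only [map_sum, Finset.sum_apply, pair_apply, Matrix.of_apply]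
    refine Finset.sum_congr rfl fun i _ => Finset.sum_congr rfl fun j _ => ?_
    rw [← mul_one (M i j), ← smul_eq_mul (M i j), ← Matrix.smul_single, map_smul]
    simp [mul_comm]
  rw [h2, h1, ← LinearMap.comp_apply, hg]
  simp [Pi.single_apply]

theorem pair_comb [DecidableEq J] {T d : J → Matrix ι ι ℂ}
    (hd : ∀ a b, pair ℂ (d a) (T b) = if a = b then 1 else 0) (k : J → A) (a : J) :
    pair A (d a) (comb A T k) = k a := by
  simp [comb_eq_sum, pair_tm, hd]

theorem comb_injective [DecidableEq ι] {T : J → Matrix ι ι ℂ} (hT : LinearIndependent ℂ T) :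
    Function.Injective (comb A T) := by
  classical
  obtain ⟨d, hd⟩ := exists_dual_family hT
  intro k k' h
  funext a
  rw [← pair_comb hd k, h, pair_comb hd]

/-- A matrix over `A` lies in `span T ⊗ A` if all its images under functionals on `A` lie in
`span T`. -/
theorem exists_eq_comb [DecidableEq ι] {T : J → Matrix ι ι ℂ} (hT : LinearIndependent ℂ T)
    (F : Matrix ι ι A) (h : ∀ θ : A →ₗ[ℂ] ℂ, ∃ a : J → ℂ, F.map θ = comb ℂ T a) :
    ∃ k, F = comb A T k := by
  classical
  obtain ⟨d, hd⟩ := exists_dual_family hT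
  refine ⟨fun l => pair A (d l) F, ?_⟩
  ext i j
  rw [← sub_eq_zero, ← Module.forall_dual_apply_eq_zero_iff ℂ]
  intro θ
  obtain ⟨a, ha⟩ := h θ
  have h1 : ∀ l, θ (pair A (d l) F) = a l := fun l => by rw [← pair_map, ha, pair_comb hd]
  have h2 := congrFun (congrFun ha i) j
  rw [Matrix.map_apply, comb_apply] at h2
  rw [map_sub, h2, comb_apply]
  simp [h1]

end Tensors

section Entries

variable {Λ ι n : Type*} [Fintype Λ] [Fintype ι] [DecidableEq ι] [Fintype n] [DecidableEq n]
variable {A A' : Type*} [Ring A] [Algebra ℂ A] [Ring A'] [Algebra ℂ A']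

theorem lie_mat₁_mat₂_apply {R : Type*} [Ring R] (F G : Matrix ι ι R) (i j k l : ι) :
    ⁅mat₁ F, mat₂ G⁆ (i, k) (j, l) = ⁅F i j, G k l⁆ := by
  simp [Ring.lie_def, mat₁, mat₂, Matrix.mul_apply, Fintype.sum_prod_type, Matrix.one_apply,
    Matrix.sub_apply]

theorem lie_scal_apply (M : Matrix n n ℂ) (F : Matrix n n A) (i j : n) :
    ⁅scal A M, F⁆ i j = ∑ k, (M i k • F k j - M k j • F i k) := by
  simp [Ring.lie_def, scal, Matrix.mul_apply, Matrix.sub_apply, Algebra.smul_def,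
    Algebra.commutes]

theorem lie_scal_tens_mat₂_apply (P Q : Λ → Matrix ι ι ℂ) (G : Matrix ι ι A) (i j k l : ι) :
    ⁅scal A (tens P Q), mat₂ G⁆ (i, k) (j, l) = ∑ m, P m i j • ⁅scal A (Q m), G⁆ k l := by
  simp only [lie_scal_apply, Finset.smul_sum]
  rw [Fintype.sum_prod_type, Finset.sum_comm, Finset.sum_comm (γ := Λ)]
  refine Finset.sum_congr rfl fun b _ => ?_
  simp only [mat₂, tens, Matrix.sum_apply, Matrix.kronecker_apply, Matrix.one_apply, ite_mul,
    one_mul, zero_mul, smul_ite, smul_zero, Finset.sum_sub_distrib, Finset.sum_ite_eq,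
    Finset.sum_ite_eq', Finset.mem_univ, if_true, Finset.sum_smul, smul_sub, smul_smul]

theorem lie_scal_tens_mat₁_apply (P Q : Λ → Matrix ι ι ℂ) (G : Matrix ι ι A) (i j k l : ι) :
    ⁅scal A (tens P Q), mat₁ G⁆ (i, k) (j, l) = ∑ m, Q m k l • ⁅scal A (P m), G⁆ i j := by
  simp only [lie_scal_apply, Finset.smul_sum]
  rw [Fintype.sum_prod_type, Finset.sum_comm (γ := Λ)]
  refine Finset.sum_congr rfl fun b _ => ?_
  simp only [mat₁, tens, Matrix.sum_apply, Matrix.kronecker_apply, Matrix.one_apply, mul_ite,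
    mul_one, mul_zero, smul_ite, smul_zero, Finset.sum_sub_distrib, Finset.sum_ite_eq,
    Finset.sum_ite_eq', Finset.mem_univ, if_true, Finset.sum_smul, smul_sub, smul_smul,
    mul_comm]

/-- Bracketing with a complex matrix commutes with applying a linear map to the entries. -/
theorem map_lie_scal (D : A →ₗ[ℂ] A') (M : Matrix n n ℂ) (F : Matrix n n A) :
    (⁅scal A M, F⁆).map D = ⁅scal A' M, F.map D⁆ := by
  ext i j
  simp [lie_scal_apply]

theorem map_lie_scal_right (D : A →ₗ[ℂ] A') (M : Matrix n n ℂ) (F : Matrix n n A) :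
    (⁅F, scal A M⁆).map D = ⁅F.map D, scal A' M⁆ := by
  rw [← lie_skew, ← lie_skew (F.map D), ← map_lie_scal]
  ext i j
  simp only [Matrix.map_apply, Matrix.neg_apply, map_neg]

theorem map_omegaMat (D : A →ₗ[ℂ] A') (P : Λ → Matrix ι ι ℂ) (F : Matrix ι ι A) :
    (omegaMat P F).map D = omegaMat P (F.map D) := by
  simp only [omegaMat, ← map_lie_scal]
  ext i j
  simp [Matrix.sum_apply]

theorem map_kMat (D : A →ₗ[ℂ] A') (P : Λ → Matrix ι ι ℂ) (c : ℂ) (F : Matrix ι ι A) :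
    (kMat P c F).map D = kMat P c (F.map D) := by
  simp only [kMat, ← map_omegaMat]
  ext i j
  simp

/-- `ω` as a linear map. -/
noncomputable def omegaLin (A : Type*) [Ring A] [Algebra ℂ A] (P : Λ → Matrix ι ι ℂ) :
    Matrix ι ι A →ₗ[ℂ] Matrix ι ι A where
  toFun := omegaMat P
  map_add' F G := by simp [omegaMat, Finset.sum_add_distrib]
  map_smul' a F := by simp [omegaMat, Finset.smul_sum]

/-- The map `F ↦ F - c⁻¹ ω(F)` as a linear map. -/
noncomputable def kLin (A : Type*) [Ring A] [Algebra ℂ A] (P : Λ → Matrix ι ι ℂ) (c : ℂ) :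
    Matrix ι ι A →ₗ[ℂ] Matrix ι ι A :=
  LinearMap.id - c⁻¹ • omegaLin A P

theorem omegaLin_apply (P : Λ → Matrix ι ι ℂ) (F : Matrix ι ι A) :
    omegaLin A P F = omegaMat P F := rfl

theorem kLin_apply (P : Λ → Matrix ι ι ℂ) (c : ℂ) (F : Matrix ι ι A) :
    kLin A P c F = kMat P c F := rfl

theorem lie_scal_tm (M N : Matrix ι ι ℂ) (a : A) :
    ⁅scal A M, tm A ι N a⁆ = tm A ι ⁅M, N⁆ a := by
  ext i j
  rw [lie_scal_apply, tm_apply, Ring.lie_def, Matrix.sub_apply, Matrix.mul_apply,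
    Matrix.mul_apply, ← Finset.sum_sub_distrib, Finset.sum_smul]
  refine Finset.sum_congr rfl fun k _ => ?_
  rw [tm_apply, tm_apply, smul_smul, smul_smul, ← sub_smul, mul_comm (N i k)]

end Entries

/-! ### Matrices solving the defining relations -/

section Classification

variable {𝔤 : Type*} [LieRing 𝔤] [LieAlgebra ℂ 𝔤] {Λ ι I : Type*} [Fintype Λ]
  [DecidableEq Λ] [Fintype ι] [DecidableEq ι] [Fintype I]

/-- The data of a module over the Yangian in matrix form, as far as the classification of the
matrices `F` needs it: `p x` and `q x` are the matrices of `x` and `J(x)`, and `S` is a basis of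
the commutant of all `p x` and `q x`. The basis `X` is orthonormal for the invariant form `B`, and
the Casimir element acts by the scalar `c` in the adjoint representation. Of the defining relations
of the Yangian, only those for `[x, y]` and `[J(x), y]` are retained. -/
structure IsMatrixRep (B : LinearMap.BilinForm ℂ 𝔤) (X : Module.Basis Λ ℂ 𝔤) (c : ℂ)
    (p : 𝔤 →ₗ⁅ℂ⁆ Matrix ι ι ℂ) (q : 𝔤 →ₗ[ℂ] Matrix ι ι ℂ) (S : I → Matrix ι ι ℂ) : Prop where
  symm : ∀ x y, B x y = B y x
  inv : ∀ x y z, B ⁅x, y⁆ z = B x ⁅y, z⁆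
  orth : ∀ l m, B (X l) (X m) = if l = m then 1 else 0
  casimir : ∀ x, adCasimir X x = c • x
  ne_zero : c ≠ 0
  p_inj : Function.Injective p
  q_lie : ∀ x y, q ⁅x, y⁆ = ⁅q x, p y⁆
  lie_p_S : ∀ x l, ⁅p x, S l⁆ = 0
  lie_q_S : ∀ x l, ⁅q x, S l⁆ = 0
  S_indep : LinearIndependent ℂ S
  S_span : ∀ M, (∀ x, ⁅p x, M⁆ = 0) → (∀ x, ⁅q x, M⁆ = 0) → ∃ a : I → ℂ, M = comb ℂ S a

variable {B : LinearMap.BilinForm ℂ 𝔤} {X : Module.Basis Λ ℂ 𝔤} {c : ℂ}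
  {p : 𝔤 →ₗ⁅ℂ⁆ Matrix ι ι ℂ} {q : 𝔤 →ₗ[ℂ] Matrix ι ι ℂ} {S : I → Matrix ι ι ℂ}
  {A : Type*} [Ring A] [Algebra ℂ A]

/-- The representation `p`, with values in matrices over `A`. -/
noncomputable def scalLie (A : Type*) [Ring A] [Algebra ℂ A] (p : 𝔤 →ₗ⁅ℂ⁆ Matrix ι ι ℂ) :
    𝔤 →ₗ⁅ℂ⁆ Matrix ι ι A :=
  ((Algebra.ofId ℂ A).mapMatrix.toLieHom).comp p

namespace IsMatrixRep

variable (hR : IsMatrixRep B X c p q S)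

include hR

theorem indep_p : LinearIndependent ℂ fun l => p (X l) :=
  X.linearIndependent.map' (p : 𝔤 →ₗ[ℂ] Matrix ι ι ℂ) (LinearMap.ker_eq_bot.mpr hR.p_inj)

theorem lie_comb_p (x : 𝔤) (h : 𝔤 →ₗ[ℂ] A) :
    ⁅scal A (p x), comb A (fun l => p (X l)) fun l => h (X l)⁆ =
      -comb A (fun l => p (X l)) fun l => h ⁅x, X l⁆ := by
  have key := sum_lie_left_add_sum_lie_right hR.inv hR.symm hR.orth
    ((tm A ι).compl₁₂ (p : 𝔤 →ₗ[ℂ] Matrix ι ι ℂ) h) x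
  simp only [LinearMap.compl₁₂_apply, LieHom.coe_toLinearMap, LieHom.map_lie] at key
  simp only [comb_eq_sum, lie_sum, lie_scal_tm]
  exact eq_neg_of_add_eq_zero_left key

theorem lie_comb_S (x : 𝔤) (k : I → A) : ⁅scal A (p x), comb A S k⁆ = 0 := by
  simp [comb_eq_sum, lie_sum, lie_scal_tm, hR.lie_p_S]

theorem omegaMat_lie (x : 𝔤) (F : Matrix ι ι A) :
    omegaMat (fun l => p (X l)) ⁅scal A (p x), F⁆ =
      ⁅scal A (p x), omegaMat (fun l => p (X l)) F⁆ :=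
  (lie_casimir_comm hR.inv hR.symm hR.orth (scalLie A p) x F).symm

theorem kMat_lie (x : 𝔤) (F : Matrix ι ι A) :
    kMat (fun l => p (X l)) c ⁅scal A (p x), F⁆ =
      ⁅scal A (p x), kMat (fun l => p (X l)) c F⁆ := by
  rw [kMat, kMat, hR.omegaMat_lie, lie_sub, lie_smul]

theorem omegaMat_comb_p (k : Λ → A) :
    omegaMat (fun l => p (X l)) (comb A (fun l => p (X l)) k) =
      c • comb A (fun l => p (X l)) k := by
  have h : ∀ y a, omegaMat (fun l => p (X l)) (tm A ι (p y) a) = c • tm A ι (p y) a := by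
    intro y a
    rw [← LinearMap.smul_apply, ← map_smul, ← map_smul p, ← hR.casimir, adCasimir_apply,
      omegaMat]
    simp only [lie_scal_tm, ← LieHom.map_lie]
    rw [← LieHom.coe_toLinearMap, map_sum, map_sum, LinearMap.sum_apply]
  rw [comb_eq_sum, ← omegaLin_apply, map_sum, Finset.smul_sum]
  exact Finset.sum_congr rfl fun l _ => h _ _

theorem kMat_comb_p (k : Λ → A) :
    kMat (fun l => p (X l)) c (comb A (fun l => p (X l)) k) = 0 := by
  rw [kMat, hR.omegaMat_comb_p, inv_smul_smul₀ hR.ne_zero, sub_self]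

theorem kMat_comb_S (k : I → A) :
    kMat (fun l => p (X l)) c (comb A S k) = comb A S k := by
  simp [kMat, omegaMat, hR.lie_comb_S]

/-- The antisymmetry of the bracket, read on the right hand side of the relation
`[F₁, F₂] = [Ω_ρ, F₂]`, forces `[x, F]` into `ρ(𝔤) ⊗ A`. There the Casimir operator acts by `c`,
so that `F - c⁻¹ ω(F)` is invariant and `c⁻¹ ω(F)` lies in `ρ(𝔤) ⊗ A`. -/
theorem exists_decomposition (F : Matrix ι ι A)
    (hF : ∀ i j k l, ∑ m, p (X m) i j • ⁅scal A (p (X m)), F⁆ k l =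
      -∑ m, p (X m) k l • ⁅scal A (p (X m)), F⁆ i j) :
    (∃ h : 𝔤 →ₗ[ℂ] A,
      F = kMat (fun l => p (X l)) c F - comb A (fun l => p (X l)) fun l => h (X l)) ∧
    ∀ m, ⁅scal A (p (X m)), kMat (fun l => p (X l)) c F⁆ = 0 := by
  obtain ⟨d, hd⟩ := exists_dual_family hR.indep_p
  have hE : ∀ m, ∃ k : Λ → A, ⁅scal A (p (X m)), F⁆ = comb A (fun l => p (X l)) k := by
    intro m
    refine ⟨fun n => -pair A (d m) ⁅scal A (p (X n)), F⁆, ?_⟩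
    ext k l
    have h1 : comb A (fun l => p (X l)) (fun n => ⁅scal A (p (X n)), F⁆ k l) =
        -∑ n, p (X n) k l • ⁅scal A (p (X n)), F⁆ := by
      ext i j
      rw [comb_apply, hF, Matrix.neg_apply, Matrix.sum_apply]
      rfl
    have h2 := congrArg (pair A (d m)) h1
    rw [pair_comb hd] at h2
    rw [h2, comb_apply, map_neg, map_sum, ← Finset.sum_neg_distrib]
    exact Finset.sum_congr rfl fun n _ => by rw [map_smul, smul_neg]
  choose k hk using hE
  constructor
  · have h1 : omegaMat (fun l => p (X l)) F ∈ LinearMap.range (comb A fun l => p (X l)) := by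
      refine Submodule.sum_mem _ fun m _ => ?_
      have h2 : k m = fun l => X.constr ℂ (k m) (X l) := by
        funext l; rw [X.constr_basis]
      rw [hk m, h2, hR.lie_comb_p]
      exact Submodule.neg_mem _ ⟨_, rfl⟩
    obtain ⟨g, hg⟩ := h1
    refine ⟨X.constr ℂ (-c⁻¹ • g), ?_⟩
    have h3 : (fun l => X.constr ℂ (-c⁻¹ • g) (X l)) = -c⁻¹ • g := by
      funext l; rw [X.constr_basis]
    rw [h3, map_smul, hg, kMat, neg_smul, sub_neg_eq_add, sub_add_cancel]
  · intro m
    rw [← hR.kMat_lie, hk m, hR.kMat_comb_p]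

/-- A complex matrix `K` commuting with all `p x`, which solves the second relation, commutes with
all `q x`: one has `[q x, K] = a p x` for a scalar `a` by Schur's lemma, and then
`a tr(p x p y) = -tr(K q[x, y])` is both symmetric and antisymmetric in `x` and `y`, whence `a = 0`
as the trace form is not zero. -/
theorem lie_q_eq_zero [LieAlgebra.IsSimple ℂ 𝔤] (K : Matrix ι ι ℂ) (hK : ∀ x, ⁅p x, K⁆ = 0)
    (hrel : ∀ i j k l, ∑ m, p (X m) i j • ⁅q (X m), K⁆ k l =
      ∑ m, p (X m) k l • ⁅q (X m), K⁆ i j) (x : 𝔤) : ⁅q x, K⁆ = 0 := by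
  have : FiniteDimensional ℂ 𝔤 := X.finiteDimensional_of_finite
  obtain ⟨d, hd⟩ := exists_dual_family hR.indep_p
  let T : 𝔤 →ₗ[ℂ] 𝔤 := X.constr ℂ fun m => ∑ n, pair ℂ (d m) ⁅q (X n), K⁆ • X n
  have hTX : ∀ m, ⁅q (X m), K⁆ = p (T (X m)) := fun m => by
    ext k l
    have h1 : comb ℂ (fun l => p (X l)) (fun n => ⁅q (X n), K⁆ k l) =
        ∑ n, p (X n) k l • ⁅q (X n), K⁆ := by
      ext i j
      rw [comb_apply, hrel, Matrix.sum_apply]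
      rfl
    have h2 := congrArg (pair ℂ (d m)) h1
    rw [pair_comb hd] at h2
    rw [h2, X.constr_basis, ← LieHom.coe_toLinearMap, map_sum, map_sum, Matrix.sum_apply]
    refine Finset.sum_congr rfl fun n _ => ?_
    rw [map_smul, map_smul, smul_eq_mul, mul_comm]
    rfl
  have hT : ∀ x, ⁅q x, K⁆ = p (T x) := fun x => by
    rw [← X.sum_repr x, map_sum, sum_lie, map_sum, ← LieHom.coe_toLinearMap, map_sum]
    refine Finset.sum_congr rfl fun m _ => ?_
    rw [map_smul, smul_lie, hTX, map_smul, map_smul]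
    rfl
  have hTlie : ∀ x y, T ⁅x, y⁆ = ⁅T x, y⁆ := fun x y => by
    apply hR.p_inj
    rw [← hT, hR.q_lie, lie_lie, hK, lie_zero, zero_sub, hT, LieHom.map_lie, lie_skew]
  obtain ⟨a, ha⟩ := exists_eq_smul_of_lie_equivariant T fun x y => by
    rw [← lie_skew, map_neg, hTlie, lie_skew]
  have htr : ∀ x y, a * (p x * p y).trace = -(K * q ⁅x, y⁆).trace := fun x y => by
    have h1 : a • p x = q x * K - K * q x := by
      rw [← map_smul, ← ha, ← hT, Ring.lie_def]
    rw [← smul_eq_mul, ← Matrix.trace_smul, ← Matrix.smul_mul, h1, hR.q_lie, Ring.lie_def,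
      sub_mul, mul_sub, Matrix.trace_sub, Matrix.trace_sub, mul_assoc (q x),
      Matrix.trace_mul_comm (q x), mul_assoc, mul_assoc]
    ring
  have hatr : ∀ x y, a * (p x * p y).trace = 0 := fun x y => by
    have h1 := htr x y
    have h2 := htr y x
    rw [Matrix.trace_mul_comm, ← lie_skew, map_neg, mul_neg, Matrix.trace_neg, ← h1] at h2
    linear_combination (1 / 2) * h2
  obtain ⟨y, z, hyz⟩ := exists_trace_mul_ne_zero p hR.p_inj
  have ha0 : a = 0 := (mul_eq_zero.mp (hatr y z)).resolve_right hyz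
  rw [hT, ha, ha0, zero_smul, map_zero]

/-- An invariant matrix over `A` which solves the second relation lies in
`End_{Y(𝔤)} V ⊗ A`. -/
theorem exists_eq_comb_S [LieAlgebra.IsSimple ℂ 𝔤] (K : Matrix ι ι A)
    (hK : ∀ m, ⁅scal A (p (X m)), K⁆ = 0)
    (hrel : ⁅mat₂ K, scal A (tens (fun l => p (X l)) fun l => q (X l))⁆ =
      ⁅mat₁ K, scal A (tens (fun l => q (X l)) fun l => p (X l))⁆) : ∃ k, K = comb A S k := by
  have scal_self : ∀ M : Matrix ι ι ℂ, scal ℂ M = M := fun M => rfl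
  refine exists_eq_comb hR.S_indep K fun θ => ?_
  have hθp : ∀ x, ⁅p x, K.map θ⁆ = 0 := fun x => by
    have h : ∀ m, ⁅p (X m), K.map θ⁆ = 0 := fun m => by
      rw [← scal_self (p (X m)), ← map_lie_scal θ, hK]
      ext; simp
    rw [← X.sum_repr x, ← LieHom.coe_toLinearMap, map_sum, sum_lie]
    refine Finset.sum_eq_zero fun m _ => ?_
    rw [map_smul, smul_lie, LieHom.coe_toLinearMap, h, smul_zero]
  refine hR.S_span _ hθp fun x => hR.lie_q_eq_zero _ hθp (fun i j k l => ?_) x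
  rw [← lie_skew, ← lie_skew (mat₁ K), neg_inj] at hrel
  have h1 := congrArg θ (congrFun (congrFun hrel (i, k)) (j, l))
  rw [lie_scal_tens_mat₂_apply, lie_scal_tens_mat₁_apply, map_sum, map_sum] at h1
  simpa only [map_smul, ← Matrix.map_apply (f := θ), map_lie_scal, scal_self] using h1

end IsMatrixRep

end Classification

/-! ### Representations of the current algebra of `𝔤 ⊕ 𝔷_I` -/

section CurrentRepresentations

/-- The relations on the modes `F^{(r)}` of the extended current algebra. -/
def ModeRel {Λ ι A : Type*} [Fintype Λ] [Fintype ι] [DecidableEq ι] [Ring A] [Algebra ℂ A]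
    (P Q : Λ → Matrix ι ι ℂ) (c : ℂ) (F : ℕ → Matrix ι ι A) : Prop :=
  (∀ r s, ⁅mat₁ (F r), mat₂ (F s)⁆ = ⁅scal A (tens P P), mat₂ (F (r + s))⁆) ∧
    ∀ r, ⁅mat₂ (kMat P c (F r)), scal A (tens P Q)⁆ = ⁅mat₁ (kMat P c (F r)), scal A (tens Q P)⁆

/-- The basis `𝒦_l` of the commutative Lie algebra. -/
noncomputable def AbelianLie.basis (I : Type*) : Module.Basis I ℂ (AbelianLie I) :=
  (Finsupp.basisSingleOne : Module.Basis I ℂ (I →₀ ℂ))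

theorem AbelianLie.basis_apply {I : Type*} (l : I) : AbelianLie.basis I l = AbelianLie.K l :=
  congrFun (Finsupp.coe_basisSingleOne (R := ℂ) (ι := I)) l

theorem AbelianLie.lie_eq_zero {I : Type*} (x y : AbelianLie I) : ⁅x, y⁆ = 0 := rfl

variable {𝔤 : Type*} [LieRing 𝔤] [LieAlgebra ℂ 𝔤] {Λ ι I : Type*} [Fintype Λ]
  [Fintype I]

/-- The entries of the matrix `-(ρ ⊗ 1)(Ω) + 𝒦` over `𝔤 ⊕ 𝔷_I`. -/
noncomputable def genEl (X : Λ → 𝔤) (P : Λ → Matrix ι ι ℂ) (S : I → Matrix ι ι ℂ) (i j : ι) :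
    𝔤 × AbelianLie I :=
  (-∑ l, P l i j • X l, ∑ l, S l i j • AbelianLie.K l)

/-- A family `H_r` of linear maps with `[H_r x, H_s y] = H_{r+s} [x, y]`, in other words a
representation `x z^r ↦ H_r x` of a polynomial current algebra. -/
def IsCurrentRep {L A : Type*} [LieRing L] [LieAlgebra ℂ L] [Ring A] [Algebra ℂ A]
    (H : ℕ → L →ₗ[ℂ] A) : Prop :=
  ∀ r s x y, ⁅H r x, H s y⁆ = H (r + s) ⁅x, y⁆

variable {A : Type*} [Ring A] [Algebra ℂ A]

theorem apply_genEl (X : Λ → 𝔤) (P : Λ → Matrix ι ι ℂ) (S : I → Matrix ι ι ℂ)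
    (h : 𝔤 × AbelianLie I →ₗ[ℂ] A) :
    (Matrix.of fun i j => h (genEl X P S i j)) =
      comb A S (fun l => h (0, AbelianLie.K l)) - comb A P (fun l => h (X l, 0)) := by
  ext i j
  have h1 : genEl X P S i j =
      LinearMap.inr ℂ 𝔤 (AbelianLie I) (∑ l, S l i j • AbelianLie.K l) -
        LinearMap.inl ℂ 𝔤 (AbelianLie I) (∑ l, P l i j • X l) := by
    rw [LinearMap.inr_apply, LinearMap.inl_apply, Prod.mk_sub_mk, zero_sub, sub_zero]
    rfl
  rw [Matrix.of_apply, h1, Matrix.sub_apply, comb_apply, comb_apply]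
  simp only [map_sub, map_sum, map_smul]
  rfl

variable [DecidableEq Λ] [Fintype ι] [DecidableEq ι] {B : LinearMap.BilinForm ℂ 𝔤}
  {X : Module.Basis Λ ℂ 𝔤} {c : ℂ}
  {p : 𝔤 →ₗ⁅ℂ⁆ Matrix ι ι ℂ} {q : 𝔤 →ₗ[ℂ] Matrix ι ι ℂ} {S : I → Matrix ι ι ℂ}

namespace IsMatrixRep

variable (hR : IsMatrixRep B X c p q S)

include hR

theorem kMat_genEl (h : 𝔤 × AbelianLie I →ₗ[ℂ] A) :
    kMat (fun l => p (X l)) c (Matrix.of fun i j => h (genEl X (fun l => p (X l)) S i j)) =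
      comb A S (fun l => h (0, AbelianLie.K l)) := by
  rw [apply_genEl, ← kLin_apply, map_sub, kLin_apply, kLin_apply, hR.kMat_comb_S,
    hR.kMat_comb_p, sub_zero]

theorem lie_genEl (h : 𝔤 × AbelianLie I →ₗ[ℂ] A) (x : 𝔤) :
    ⁅scal A (p x), Matrix.of fun i j => h (genEl X (fun l => p (X l)) S i j)⁆ =
      comb A (fun l => p (X l)) (fun l => h (⁅x, X l⁆, 0)) := by
  have h1 := hR.lie_comb_p x (h.comp (LinearMap.inl ℂ 𝔤 (AbelianLie I)))
  simp only [LinearMap.comp_apply, LinearMap.inl_apply] at h1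
  rw [apply_genEl, lie_sub, hR.lie_comb_S, h1, zero_sub, neg_neg]

/-- A representation of the current algebra of `𝔤 ⊕ 𝔷_I` gives a solution of the relations. -/
theorem modeRel_of_isCurrentRep {H : ℕ → 𝔤 × AbelianLie I →ₗ[ℂ] A} (hH : IsCurrentRep H) :
    ModeRel (fun l => p (X l)) (fun l => q (X l)) c
      fun r => Matrix.of fun i j => H r (genEl X (fun l => p (X l)) S i j) := by
  constructor
  · intro r s
    ext ⟨i, k⟩ ⟨j, l⟩
    rw [lie_mat₁_mat₂_apply, lie_scal_tens_mat₂_apply]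
    beta_reduce
    rw [Matrix.of_apply, Matrix.of_apply, hH]
    have h1 : ⁅genEl X (fun l => p (X l)) S i j, genEl X (fun l => p (X l)) S k l⁆ =
        LinearMap.inl ℂ 𝔤 (AbelianLie I)
          (∑ m, p (X m) i j • ∑ n, p (X n) k l • ⁅X m, X n⁆) := by
      rw [LieAlgebra.Prod.bracket_apply]
      refine Prod.ext ?_ rfl
      change ⁅-∑ m, p (X m) i j • X m, -∑ n, p (X n) k l • X n⁆ = _
      rw [neg_lie, lie_neg, neg_neg, sum_lie]
      refine Finset.sum_congr rfl fun m _ => ?_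
      simp only [smul_lie, lie_sum, lie_smul, Finset.smul_sum]
      exact Finset.sum_congr rfl fun n _ => smul_comm _ _ _
    rw [h1]
    simp only [map_sum, map_smul]
    refine Finset.sum_congr rfl fun m _ => ?_
    rw [hR.lie_genEl, comb_apply]
    rfl
  · intro r
    rw [← lie_skew, ← lie_skew (mat₁ _), neg_inj, hR.kMat_genEl]
    have hq : ∀ x, ⁅scal A (q x), comb A S (fun l => H r (0, AbelianLie.K l))⁆ = 0 := fun x => by
      simp [comb_eq_sum, lie_sum, lie_scal_tm, hR.lie_q_S]
    ext ⟨i, k⟩ ⟨j, l⟩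
    rw [lie_scal_tens_mat₂_apply, lie_scal_tens_mat₁_apply]
    simp [hq]

/-- Every solution of the relations comes from a representation of the current algebra of
`𝔤 ⊕ 𝔷_I`: writing `F^{(r)} = -∑ p(X_l) ⊗ h_r(X_l) + ∑ S_l ⊗ k_{r,l}`, the first relation makes all
`k_{r,l}` commute with the entries of the `F^{(s)}`, and its remaining part gives the bracket of
the `h_r(X_l)`. -/
theorem exists_isCurrentRep [LieAlgebra.IsSimple ℂ 𝔤] {F : ℕ → Matrix ι ι A}
    (hF : ModeRel (fun l => p (X l)) (fun l => q (X l)) c F) :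
    ∃ H : ℕ → 𝔤 × AbelianLie I →ₗ[ℂ] A, IsCurrentRep H ∧
      ∀ r, F r = Matrix.of fun i j => H r (genEl X (fun l => p (X l)) S i j) := by
  have hrel : ∀ r s i j k l, ⁅F r i j, F s k l⁆ =
      ∑ m, p (X m) i j • ⁅scal A (p (X m)), F (r + s)⁆ k l := fun r s i j k l => by
    have h := congrFun (congrFun (hF.1 r s) (i, k)) (j, l)
    rwa [lie_mat₁_mat₂_apply, lie_scal_tens_mat₂_apply] at h
  have hdec := fun r => hR.exists_decomposition (F r) fun i j k l => by
    have h1 := hrel r 0 i j k l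
    have h2 := hrel 0 r k l i j
    rw [add_zero] at h1
    rw [zero_add] at h2
    rw [← h1, ← h2, lie_skew]
  have hS := fun r => hR.exists_eq_comb_S _ (hdec r).2 (hF.2 r)
  choose h hh using fun r => (hdec r).1
  choose k hk using hS
  let κ : ℕ → AbelianLie I →ₗ[ℂ] A := fun r => (AbelianLie.basis I).constr ℂ (k r)
  have hκ : ∀ r l, κ r (AbelianLie.K l) = k r l := fun r l => by
    rw [← AbelianLie.basis_apply, Module.Basis.constr_basis]
  let H : ℕ → 𝔤 × AbelianLie I →ₗ[ℂ] A := fun r => (h r).coprod (κ r)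
  have hFH : ∀ r, F r = Matrix.of fun i j => H r (genEl X (fun l => p (X l)) S i j) := fun r => by
    rw [apply_genEl]
    conv_lhs => rw [hh r, hk r]
    simp [H, hκ]
  refine ⟨H, ?_, hFH⟩
  -- The entries of `K` commute with those of `F`: apply `kMat` to the second factor of the
  -- first relation.
  have hFK : ∀ r s i j u v, ⁅F r i j, kMat (fun l => p (X l)) c (F s) u v⁆ = 0 := by
    intro r s i j u v
    let D : A →ₗ[ℂ] A := LieAlgebra.ad ℂ A (F r i j)
    have h1 : (F s).map D = ∑ m, p (X m) i j • ⁅scal A (p (X m)), F (r + s)⁆ := by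
      ext u v
      rw [Matrix.sum_apply]
      exact hrel r s i j u v
    have h2 := map_kMat D (fun l => p (X l)) c (F s)
    rw [h1, ← kLin_apply _ _ (∑ m, _), map_sum] at h2
    have h3 : ∑ m, kLin A (fun l => p (X l)) c (p (X m) i j • ⁅scal A (p (X m)), F (r + s)⁆)
        = 0 := Finset.sum_eq_zero fun m _ => by
      rw [map_smul, kLin_apply, hR.kMat_lie, (hdec _).2, smul_zero]
    rw [h3] at h2
    exact congrFun (congrFun h2 u) v
  obtain ⟨d, hd⟩ := exists_dual_family hR.indep_p
  classical
  obtain ⟨d', hd'⟩ := exists_dual_family hR.S_indep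
  have hFk : ∀ r s i j l, ⁅F r i j, k s l⁆ = 0 := fun r s i j l => by
    rw [← pair_comb hd' (k s) l, ← hk s, pair_apply]
    simp [lie_sum, hFK]
  have hkk : ∀ r s l m, ⁅k r l, k s m⁆ = 0 := fun r s l m => by
    have h1 : ∀ i j, ⁅k s m, kMat (fun l => p (X l)) c (F r) i j⁆ = 0 := fun i j => by
      have h2 := map_kMat (LieAlgebra.ad ℂ A (k s m) : A →ₗ[ℂ] A) (fun l => p (X l)) c (F r)
      have h3 : (F r).map (LieAlgebra.ad ℂ A (k s m) : A →ₗ[ℂ] A) = 0 := by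
        ext i j
        rw [Matrix.map_apply, LieAlgebra.ad_apply, ← lie_skew, hFk, neg_zero, Matrix.zero_apply]
      rw [h3, ← kLin_apply _ _ (0 : Matrix ι ι A), map_zero] at h2
      exact congrFun (congrFun h2 i) j
    rw [← lie_skew, ← pair_comb hd' (k r) l, ← hk r, pair_apply]
    simp [lie_sum, h1]
  have hG : ∀ r i j, comb A (fun l => p (X l)) (fun l => h r (X l)) i j =
      comb A S (k r) i j - F r i j := fun r i j => by
    have h1 := congrFun (congrFun (hh r) i) j
    rw [hk r, Matrix.sub_apply] at h1
    rw [h1, sub_sub_cancel]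
  have hhk : ∀ r s m l, ⁅h r (X m), k s l⁆ = 0 := fun r s m l => by
    rw [← pair_comb hd (fun l => h r (X l)) m, pair_apply]
    simp only [hG, comb_apply, sum_lie, smul_lie, sub_lie, hkk, hFk, smul_zero,
      Finset.sum_const_zero, sub_zero]
  have hhh : ∀ r s m n, ⁅h r (X m), h s (X n)⁆ = h (r + s) ⁅X m, X n⁆ := fun r s m n => by
    have h1 : ∀ i j u v, ⁅comb A (fun l => p (X l)) (fun l => h r (X l)) i j,
        comb A (fun l => p (X l)) (fun l => h s (X l)) u v⁆ =
        ∑ m, p (X m) i j • ∑ n, p (X n) u v • h (r + s) ⁅X m, X n⁆ := fun i j u v => by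
      have h2 : ∀ r s i j u v, ⁅F r i j, comb A S (k s) u v⁆ = 0 := fun r s i j u v => by
        rw [← hk s, hFK]
      have h3 : ⁅comb A S (k r) i j, comb A S (k s) u v⁆ = 0 := by
        simp [comb_apply, sum_lie, lie_sum, hkk]
      rw [hG, hG, sub_lie, lie_sub, lie_sub, h3, h2, ← lie_skew, h2, hrel]
      simp only [zero_sub, neg_zero, sub_zero, sub_neg_eq_add, zero_add]
      refine Finset.sum_congr rfl fun m _ => ?_
      rw [hFH (r + s), hR.lie_genEl, comb_apply]
      simp [H]
    have h2 : ∀ i j, ⁅comb A (fun l => p (X l)) (fun l => h r (X l)) i j, h s (X n)⁆ =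
        ∑ m, p (X m) i j • h (r + s) ⁅X m, X n⁆ := fun i j => by
      have h3 : (comb A (fun l => p (X l)) (fun l => h s (X l))).map (LieAlgebra.ad ℂ A
          (comb A (fun l => p (X l)) (fun l => h r (X l)) i j) : A →ₗ[ℂ] A) =
          comb A (fun l => p (X l)) fun n => ∑ m, p (X m) i j • h (r + s) ⁅X m, X n⁆ := by
        ext u v
        rw [Matrix.map_apply, LieAlgebra.ad_apply, h1, comb_apply]
        simp only [Finset.smul_sum]
        rw [Finset.sum_comm]
        exact Finset.sum_congr rfl fun _ _ => Finset.sum_congr rfl fun _ _ => smul_comm _ _ _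
      have h4 := congrArg (pair A (d n)) h3
      rw [pair_map, pair_comb hd, pair_comb hd] at h4
      exact h4
    have h5 : (comb A (fun l => p (X l)) (fun l => h r (X l))).map (LieAlgebra.ad ℂ A
        (h s (X n)) : A →ₗ[ℂ] A) = comb A (fun l => p (X l)) fun m => -h (r + s) ⁅X m, X n⁆ := by
      ext i j
      rw [Matrix.map_apply, LieAlgebra.ad_apply, ← lie_skew, h2, comb_apply]
      simp
    have h6 := congrArg (pair A (d m)) h5
    rw [pair_map, pair_comb hd, pair_comb hd, LieAlgebra.ad_apply, ← lie_skew, neg_inj] at h6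
    exact h6
  -- The bracket formula holds on the basis, hence everywhere.
  have ext_h : ∀ r s x y, ⁅h r x, h s y⁆ = h (r + s) ⁅x, y⁆ := fun r s x y => by
    rw [← X.sum_repr x, ← X.sum_repr y]
    simp only [map_sum, map_smul, sum_lie, lie_sum, smul_lie, lie_smul, hhh]
  have ext_hk : ∀ r s x z, ⁅h r x, κ s z⁆ = 0 := fun r s x z => by
    rw [← X.sum_repr x, ← (AbelianLie.basis I).sum_repr z]
    simp only [map_sum, map_smul, sum_lie, lie_sum, smul_lie, lie_smul, AbelianLie.basis_apply,
      hκ, hhk, smul_zero, Finset.sum_const_zero]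
  have ext_k : ∀ r s z w, ⁅κ r z, κ s w⁆ = 0 := fun r s z w => by
    rw [← (AbelianLie.basis I).sum_repr z, ← (AbelianLie.basis I).sum_repr w]
    simp only [map_sum, map_smul, sum_lie, lie_sum, smul_lie, lie_smul, AbelianLie.basis_apply,
      hκ, hkk, smul_zero, Finset.sum_const_zero]
  rintro r s ⟨x, z⟩ ⟨y, w⟩
  rw [LieAlgebra.Prod.bracket_apply, AbelianLie.lie_eq_zero]
  simp only [H, LinearMap.coprod_apply, map_zero, add_zero, add_lie, lie_add, ext_h, ext_hk, ext_k]
  rw [← lie_skew (κ r z), ext_hk, neg_zero, add_zero]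

end IsMatrixRep

end CurrentRepresentations

/-! ### Relations in formal series and relations on modes -/

section Series

theorem coeff_invUV (A : Type*) [Ring A] (n : ℕ) : PowerSeries.coeff n (invUV A) =
    if n = 0 then 0 else HahnSeries.single (1 - n : ℤ) 1 := by
  rcases n with _ | n
  · simp [invUV]
  · rw [invUV, PowerSeries.coeff_mk, if_neg (Nat.succ_ne_zero n)]
    have h : (1 - (n + 1 : ℕ) : ℤ) = -n := by push_cast; ring
    rw [h]

theorem invUV_mul_comm {A : Type*} [Ring A] (y : PowerSeries (LaurentSeries A)) :
    invUV A * y = y * invUV A := by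
  ext1 n
  rw [PowerSeries.coeff_mul, PowerSeries.coeff_mul]
  refine Finset.sum_equiv (Equiv.prodComm ℕ ℕ) (by simp [add_comm]) fun p _ => ?_
  rw [Equiv.prodComm_apply, Prod.fst_swap, Prod.snd_swap, coeff_invUV]
  split_ifs
  · simp
  · ext m
    simp [HahnSeries.coeff_single_mul, HahnSeries.coeff_mul_single]

section Modes

variable {ι A A' : Type*} [Ring A] [Ring A']

/-- The mode `F^{(k)}`, with the convention that the modes of negative degree are zero. -/
def mode (F : ℕ → Matrix ι ι A) (k : ℤ) : Matrix ι ι A := if 0 ≤ k then F k.toNat else 0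

theorem mode_natCast (F : ℕ → Matrix ι ι A) (k : ℕ) : mode F k = F k := by simp [mode]

theorem mode_of_neg (F : ℕ → Matrix ι ι A) {k : ℤ} (hk : k < 0) : mode F k = 0 := by
  rw [mode, if_neg (by omega)]

theorem coeff_serMat (F : ℕ → Matrix ι ι A) (n : ℕ) (i j : ι) :
    PowerSeries.coeff n (serMat F i j) = mode F (n - 1) i j := by
  rcases n with _ | n
  · simp [serMat, mode]
  · simp [serMat, mode]

theorem coeff_ofPowerSeries_serMat (F : ℕ → Matrix ι ι A) (m : ℤ) (i j : ι) :
    (HahnSeries.ofPowerSeries ℤ A (serMat F i j)).coeff m = mode F (m - 1) i j := by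
  rw [PowerSeries.coeff_coe]
  split_ifs with h
  · rw [mode_of_neg F (by omega), Matrix.zero_apply]
  · rw [coeff_serMat]
    congr 2
    omega

theorem mode_map [Algebra ℂ A] [Algebra ℂ A'] (φ : A →ₗ[ℂ] A') (F : ℕ → Matrix ι ι A) (k : ℤ) :
    (mode F k).map φ = mode (fun r => (F r).map φ) k := by
  unfold mode
  split_ifs
  · rfl
  · ext; simp

end Modes

section Kronecker

variable {ι A A' : Type*} [DecidableEq ι] [Ring A] [Algebra ℂ A] [Ring A'] [Algebra ℂ A']

theorem map_mat₁ (D : A →ₗ[ℂ] A') (F : Matrix ι ι A) : (mat₁ F).map D = mat₁ (F.map D) := by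
  ext ⟨i, k⟩ ⟨j, l⟩
  simp only [mat₁, Matrix.map_apply, Matrix.kronecker_apply, Matrix.one_apply]
  split_ifs <;> simp

theorem map_mat₂ (D : A →ₗ[ℂ] A') (F : Matrix ι ι A) : (mat₂ F).map D = mat₂ (F.map D) := by
  ext ⟨i, k⟩ ⟨j, l⟩
  simp only [mat₂, Matrix.map_apply, Matrix.kronecker_apply, Matrix.one_apply]
  split_ifs <;> simp

end Kronecker

variable {Λ ι : Type*}
variable {A A' : Type*} [Ring A] [Algebra ℂ A] [Ring A'] [Algebra ℂ A']

/-- The coefficient of `u^{-n} v^{-m}`. -/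
noncomputable def coeffUV (A : Type*) [Ring A] [Algebra ℂ A] (n : ℕ) (m : ℤ) :
    PowerSeries (LaurentSeries A) →ₗ[ℂ] A where
  toFun y := (PowerSeries.coeff n y).coeff m
  map_add' x y := by simp
  map_smul' a x := rfl

/-- The coefficient of `u^{-n}`. -/
noncomputable def coeffU (A : Type*) [Ring A] [Algebra ℂ A] (n : ℕ) : PowerSeries A →ₗ[ℂ] A where
  toFun y := PowerSeries.coeff n y
  map_add' x y := by simp
  map_smul' a x := rfl

theorem coeffUV_apply (n : ℕ) (m : ℤ) (y : PowerSeries (LaurentSeries A)) :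
    coeffUV A n m y = (PowerSeries.coeff n y).coeff m := rfl

theorem coeffU_apply (n : ℕ) (y : PowerSeries A) : coeffU A n y = PowerSeries.coeff n y := rfl

theorem eq_of_coeffUV_eq {x y : PowerSeries (LaurentSeries A)}
    (h : ∀ n m, coeffUV A n m x = coeffUV A n m y) : x = y := by
  ext n m
  exact h n m

/-- The coefficients of `(u - v)⁻¹ y` as linear functions of `y`. -/
noncomputable def coeffInvUV (A : Type*) [Ring A] [Algebra ℂ A] (n : ℕ) (m : ℤ) :
    PowerSeries (LaurentSeries A) →ₗ[ℂ] A :=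
  (coeffUV A n m).comp (LinearMap.mulLeft ℂ (invUV A))

theorem coeffUV_lie_invUV_smul {n : Type*} [Fintype n] [DecidableEq n] (M : Matrix n n ℂ)
    (Y : Matrix n n (PowerSeries (LaurentSeries A))) (a : ℕ) (b : ℤ) :
    (⁅invUV A • scal (PowerSeries (LaurentSeries A)) M, Y⁆).map (coeffUV A a b) =
      ⁅scal A M, Y.map (coeffInvUV A a b)⁆ := by
  rw [← map_lie_scal]
  ext i j
  rw [Matrix.map_apply, Matrix.map_apply, coeffInvUV, LinearMap.comp_apply]
  congr 1
  simp only [Ring.lie_def, Matrix.sub_apply, Matrix.mul_apply, Matrix.smul_apply,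
    LinearMap.mulLeft_apply, mul_sub, Finset.mul_sum, smul_eq_mul, mul_assoc]
  congr 1
  refine Finset.sum_congr rfl fun k _ => ?_
  rw [← mul_assoc, ← mul_assoc, invUV_mul_comm]

theorem coeffUV_lie (f : PowerSeries A) (g : LaurentSeries A) (n : ℕ) (m : ℤ) :
    coeffUV A n m ⁅PowerSeries.map (HahnSeries.C : A →+* LaurentSeries A) f, PowerSeries.C g⁆ =
      ⁅PowerSeries.coeff n f, g.coeff m⁆ := by
  rw [coeffUV_apply, Ring.lie_def, Ring.lie_def, map_sub, PowerSeries.coeff_mul_C,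
    PowerSeries.coeff_C_mul, PowerSeries.coeff_map, HahnSeries.coeff_sub, HahnSeries.C_apply,
    HahnSeries.coeff_single_mul, HahnSeries.coeff_mul_single, sub_zero]

theorem coeffInvUV_map (f : PowerSeries A) (n : ℕ) (m : ℤ) :
    coeffInvUV A n m (PowerSeries.map (HahnSeries.C : A →+* LaurentSeries A) f) =
      if 1 ≤ n + m ∧ m ≤ 0 then PowerSeries.coeff (n + m - 1).toNat f else 0 := by
  have key : ∀ a b : ℕ,
      (PowerSeries.coeff a (invUV A) * HahnSeries.C (PowerSeries.coeff b f)).coeff m =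
        if (a : ℤ) = 1 - m ∧ a ≠ 0 then PowerSeries.coeff b f else 0 := fun a b => by
    rw [coeff_invUV]
    split_ifs with h1 h2 h2
    · exact absurd h1 h2.2
    · simp
    · rw [HahnSeries.C_apply, HahnSeries.single_mul_single, HahnSeries.coeff_single,
        if_pos (by omega), one_mul]
    · rw [HahnSeries.C_apply, HahnSeries.single_mul_single, HahnSeries.coeff_single,
        if_neg (by omega)]
  rw [coeffInvUV, LinearMap.comp_apply, LinearMap.mulLeft_apply, coeffUV_apply,
    PowerSeries.coeff_mul, HahnSeries.coeff_sum]
  simp only [PowerSeries.coeff_map, key]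
  split_ifs with h
  · rw [Finset.sum_eq_single ((1 - m).toNat, (n + m - 1).toNat)]
    · rw [if_pos (by omega)]
    · rintro ⟨a, b⟩ hab hne
      rw [Finset.HasAntidiagonal.mem_antidiagonal] at hab
      rw [if_neg]
      rintro ⟨h1, h2⟩
      apply hne
      simp only at h1 h2 hab
      rw [Prod.mk.injEq]
      omega
    · intro hab
      rw [Finset.HasAntidiagonal.mem_antidiagonal] at hab
      omega
  · refine Finset.sum_eq_zero fun ⟨a, b⟩ hab => ?_
    rw [Finset.HasAntidiagonal.mem_antidiagonal] at hab
    rw [if_neg]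
    simp only at hab ⊢
    omega

theorem coeffInvUV_C (g : LaurentSeries A) (n : ℕ) (m : ℤ) :
    coeffInvUV A n m (PowerSeries.C g) = if n = 0 then 0 else g.coeff (n + m - 1) := by
  rw [coeffInvUV, LinearMap.comp_apply, LinearMap.mulLeft_apply, coeffUV_apply,
    PowerSeries.coeff_mul_C, coeff_invUV]
  split_ifs
  · simp
  · rw [HahnSeries.coeff_single_mul, one_mul]
    congr 1
    ring

theorem serMat_map_coeffU (F : ℕ → Matrix ι ι A) (n : ℕ) :
    (serMat F).map (coeffU A n) = mode F (n - 1) := by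
  ext i j
  exact coeff_serMat F n i j

theorem serU_map_coeffInvUV (F : ℕ → Matrix ι ι A) (n : ℕ) (m : ℤ) :
    (serU F).map (coeffInvUV A n m) = if m ≤ 0 then mode F (n + m - 2) else 0 := by
  ext i j
  rw [Matrix.map_apply, serU, Matrix.map_apply, coeffInvUV_map, coeff_serMat]
  by_cases hm : m ≤ 0
  · by_cases hn : 1 ≤ n + m
    · rw [if_pos ⟨hn, hm⟩, if_pos hm]
      have h : ((n + m - 1).toNat : ℤ) - 1 = n + m - 2 := by omega
      rw [h]
    · rw [if_neg (by omega), if_pos hm, mode_of_neg F (by omega), Matrix.zero_apply]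
  · rw [if_neg (by omega), if_neg hm, Matrix.zero_apply]

theorem serV_map_coeffInvUV (F : ℕ → Matrix ι ι A) (n : ℕ) (m : ℤ) :
    (serV F).map (coeffInvUV A n m) = if n = 0 then 0 else mode F (n + m - 2) := by
  ext i j
  rw [Matrix.map_apply, serV, Matrix.map_apply, coeffInvUV_C, coeff_ofPowerSeries_serMat]
  split_ifs
  · rfl
  · rw [sub_sub, one_add_one_eq_two]

variable [Fintype Λ] [Fintype ι] [DecidableEq ι]

theorem rLeft_map_coeffUV (F : ℕ → Matrix ι ι A) (n : ℕ) (m : ℤ) :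
    (rLeft F).map (coeffUV A n m) = ⁅mat₁ (mode F (n - 1)), mat₂ (mode F (m - 1))⁆ := by
  ext ⟨i, k⟩ ⟨j, l⟩
  rw [Matrix.map_apply, rLeft, lie_mat₁_mat₂_apply, lie_mat₁_mat₂_apply, serU, serV,
    Matrix.map_apply, Matrix.map_apply, coeffUV_lie, coeff_serMat, coeff_ofPowerSeries_serMat]

theorem rRight_map_coeffUV (P : Λ → Matrix ι ι ℂ) (F : ℕ → Matrix ι ι A) (n : ℕ) (m : ℤ) :
    (rRight P F).map (coeffUV A n m) = ⁅scal A (tens P P),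
      mat₁ (if m ≤ 0 then mode F (n + m - 2) else 0) +
        mat₂ (if n = 0 then 0 else mode F (n + m - 2))⁆ := by
  rw [rRight, coeffUV_lie_invUV_smul, Matrix.map_add _ (map_add _), map_mat₁, map_mat₂,
    serU_map_coeffInvUV, serV_map_coeffInvUV]

theorem kLeft_map_coeffU (P Q : Λ → Matrix ι ι ℂ) (c : ℂ) (F : ℕ → Matrix ι ι A) (n : ℕ) :
    (kLeft P Q c F).map (coeffU A n) =
      ⁅mat₂ (kMat P c (mode F (n - 1))), scal A (tens P Q)⁆ := by
  rw [kLeft, ← serMat_map_coeffU, ← map_kMat, ← map_mat₂, map_lie_scal_right]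

theorem kRight_map_coeffU (P Q : Λ → Matrix ι ι ℂ) (c : ℂ) (F : ℕ → Matrix ι ι A) (n : ℕ) :
    (kRight P Q c F).map (coeffU A n) =
      ⁅mat₁ (kMat P c (mode F (n - 1))), scal A (tens Q P)⁆ := by
  rw [kRight, ← serMat_map_coeffU, ← map_kMat, ← map_mat₁, map_lie_scal_right]

/-- The coefficients with `m ≥ 1` of the first relation in formal series are the relations on the
modes. Those with `m ≤ 0` say that `[Ω_ρ, F₁ + F₂] = 0` for each mode `F`, which follows by
exchanging the tensor factors. -/
theorem modeRel_iff (P Q : Λ → Matrix ι ι ℂ) (c : ℂ) (F : ℕ → Matrix ι ι A) :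
    ModeRel P Q c F ↔ rLeft F = rRight P F ∧ kLeft P Q c F = kRight P Q c F := by
  constructor
  · rintro ⟨h1, h2⟩
    have hflip : ∀ t, ⁅scal A (tens P P), mat₁ (F t) + mat₂ (F t)⁆ = 0 := fun t => by
      ext ⟨i, k⟩ ⟨j, l⟩
      have ha := congrFun (congrFun (h1 t 0) (i, k)) (j, l)
      have hb := congrFun (congrFun (h1 0 t) (k, i)) (l, j)
      rw [lie_mat₁_mat₂_apply, lie_scal_tens_mat₂_apply, add_zero] at ha
      rw [lie_mat₁_mat₂_apply, lie_scal_tens_mat₂_apply, zero_add] at hb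
      rw [lie_add, Matrix.add_apply, lie_scal_tens_mat₁_apply, lie_scal_tens_mat₂_apply, ← ha,
        ← hb, ← lie_skew, neg_add_cancel, Matrix.zero_apply]
    constructor
    · refine Matrix.ext fun p q => eq_of_coeffUV_eq (A := A) fun n m => ?_
      rw [← Matrix.map_apply (f := coeffUV A n m), ← Matrix.map_apply (f := coeffUV A n m),
        rLeft_map_coeffUV, rRight_map_coeffUV]
      have mat₁_zero : mat₁ (0 : Matrix ι ι A) = 0 := by simp [mat₁]
      have mat₂_zero : mat₂ (0 : Matrix ι ι A) = 0 := by simp [mat₂]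
      rcases n with _ | n
      · rw [mode_of_neg F (by simp), if_pos rfl]
        split_ifs with hm
        · rw [mode_of_neg F (show m - 1 < 0 by omega),
            mode_of_neg F (show ((0 : ℕ) : ℤ) + m - 2 < 0 by omega), mat₁_zero, mat₂_zero]
          simp
        · simp [mat₁_zero, mat₂_zero]
      · rw [if_neg (Nat.succ_ne_zero n)]
        split_ifs with hm
        · rw [mode_of_neg F (show m - 1 < 0 by omega), mat₂_zero, lie_zero]
          by_cases ht : 0 ≤ ((n + 1 : ℕ) : ℤ) + m - 2
          · rw [mode, if_pos ht, hflip]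
          · rw [mode, if_neg ht, mat₁_zero, mat₂_zero, add_zero, lie_zero]
        · obtain ⟨s, rfl⟩ : ∃ s : ℕ, m = s + 1 := ⟨(m - 1).toNat, by omega⟩
          have e1 : ((n + 1 : ℕ) : ℤ) - 1 = n := by push_cast; ring
          have e2 : (s + 1 : ℤ) - 1 = s := by ring
          have e3 : ((n + 1 : ℕ) : ℤ) + (s + 1) - 2 = (n + s : ℕ) := by push_cast; ring
          rw [e1, e2, e3, mode_natCast, mode_natCast, mode_natCast, mat₁_zero, zero_add, h1]
    · ext p q n
      rw [← coeffU_apply, ← coeffU_apply, ← Matrix.map_apply (f := coeffU A n),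
        ← Matrix.map_apply (f := coeffU A n), kLeft_map_coeffU, kRight_map_coeffU]
      rcases n with _ | n
      · rw [mode_of_neg F (by simp), ← kLin_apply P c (0 : Matrix ι ι A), map_zero]
        simp [mat₁, mat₂]
      · have e1 : ((n + 1 : ℕ) : ℤ) - 1 = n := by push_cast; ring
        rw [e1, mode_natCast, h2]
  · rintro ⟨h1, h2⟩
    constructor
    · intro r s
      have h := congrArg (fun M => M.map (coeffUV A (r + 1) (s + 1))) h1
      have e1 : ((r + 1 : ℕ) : ℤ) - 1 = r := by push_cast; ring
      have e2 : (s + 1 : ℤ) - 1 = s := by ring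
      have e3 : ((r + 1 : ℕ) : ℤ) + (s + 1) - 2 = (r + s : ℕ) := by push_cast; ring
      have mat₁_zero : mat₁ (0 : Matrix ι ι A) = 0 := by simp [mat₁]
      simpa only [rLeft_map_coeffUV, rRight_map_coeffUV, e1, e2, e3, mode_natCast,
        if_neg (Nat.succ_ne_zero r), if_neg (show ¬ (s + 1 : ℤ) ≤ 0 by omega), mat₁_zero,
        zero_add] using h
    · intro r
      have h := congrArg (fun M => M.map (coeffU A (r + 1))) h2
      have e1 : ((r + 1 : ℕ) : ℤ) - 1 = r := by push_cast; ring
      simpa only [kLeft_map_coeffU, kRight_map_coeffU, e1, mode_natCast] using h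

/-- The coefficients of both sides of the relations are natural in the algebra. -/
theorem map_coeff_rLeft (φ : A →ₐ[ℂ] A') (F : ℕ → Matrix ι ι A) (p q : ι × ι) (n : ℕ) (m : ℤ) :
    φ (coeffUV A n m (rLeft F p q)) = coeffUV A' n m (rLeft (fun r => (F r).map φ) p q) := by
  rw [← Matrix.map_apply (f := coeffUV A n m), ← Matrix.map_apply (f := coeffUV A' n m),
    rLeft_map_coeffUV, rLeft_map_coeffUV]
  obtain ⟨i, k⟩ := p
  obtain ⟨j, l⟩ := q
  have h : ∀ t, (mode F t).map φ = mode (fun r => (F r).map φ) t := mode_map φ.toLinearMap F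
  rw [lie_mat₁_mat₂_apply, lie_mat₁_mat₂_apply, ← h, ← h, Ring.lie_def, Ring.lie_def, map_sub,
    map_mul, map_mul]
  rfl

theorem map_coeff_rRight (φ : A →ₐ[ℂ] A') (P : Λ → Matrix ι ι ℂ) (F : ℕ → Matrix ι ι A)
    (p q : ι × ι) (n : ℕ) (m : ℤ) :
    φ (coeffUV A n m (rRight P F p q)) = coeffUV A' n m (rRight P (fun r => (F r).map φ) p q) := by
  rw [← Matrix.map_apply (f := coeffUV A n m), ← Matrix.map_apply (f := coeffUV A' n m),
    rRight_map_coeffUV, rRight_map_coeffUV]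
  have h : ∀ t, (mode F t).map φ.toLinearMap = mode (fun r => (F r).map φ) t :=
    mode_map φ.toLinearMap F
  have h0 : (0 : Matrix ι ι A).map φ.toLinearMap = 0 := by ext; simp
  rw [← AlgHom.toLinearMap_apply φ, ← Matrix.map_apply (f := φ.toLinearMap), map_lie_scal,
    Matrix.map_add _ (map_add _), map_mat₁, map_mat₂]
  split_ifs <;> simp only [h, h0]

theorem map_coeff_kLeft (φ : A →ₐ[ℂ] A') (P Q : Λ → Matrix ι ι ℂ) (c : ℂ)
    (F : ℕ → Matrix ι ι A) (p q : ι × ι) (n : ℕ) :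
    φ (coeffU A n (kLeft P Q c F p q)) = coeffU A' n (kLeft P Q c (fun r => (F r).map φ) p q) := by
  rw [← Matrix.map_apply (f := coeffU A n), ← Matrix.map_apply (f := coeffU A' n),
    kLeft_map_coeffU, kLeft_map_coeffU]
  have h : ∀ t, (mode F t).map φ.toLinearMap = mode (fun r => (F r).map φ) t :=
    mode_map φ.toLinearMap F
  rw [← AlgHom.toLinearMap_apply φ, ← Matrix.map_apply (f := φ.toLinearMap), map_lie_scal_right,
    map_mat₂, map_kMat, h]

theorem map_coeff_kRight (φ : A →ₐ[ℂ] A') (P Q : Λ → Matrix ι ι ℂ) (c : ℂ)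
    (F : ℕ → Matrix ι ι A) (p q : ι × ι) (n : ℕ) :
    φ (coeffU A n (kRight P Q c F p q)) =
      coeffU A' n (kRight P Q c (fun r => (F r).map φ) p q) := by
  rw [← Matrix.map_apply (f := coeffU A n), ← Matrix.map_apply (f := coeffU A' n),
    kRight_map_coeffU, kRight_map_coeffU]
  have h : ∀ t, (mode F t).map φ.toLinearMap = mode (fun r => (F r).map φ) t :=
    mode_map φ.toLinearMap F
  rw [← AlgHom.toLinearMap_apply φ, ← Matrix.map_apply (f := φ.toLinearMap), map_lie_scal_right,
    map_mat₁, map_kMat, h]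

end Series

/-! ### Enveloping algebras and algebras given by presentations -/

section Enveloping

variable {L L' : Type*} [LieRing L] [LieAlgebra ℂ L] [LieRing L'] [LieAlgebra ℂ L']

/-- The isomorphism of enveloping algebras induced by an isomorphism of Lie algebras. -/
noncomputable def uEquiv (f : L ≃ₗ⁅ℂ⁆ L') :
    UniversalEnvelopingAlgebra ℂ L ≃ₐ[ℂ] UniversalEnvelopingAlgebra ℂ L' :=
  AlgEquiv.ofAlgHom
    (UniversalEnvelopingAlgebra.lift ℂ ((UniversalEnvelopingAlgebra.ι ℂ).comp f.toLieHom))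
    (UniversalEnvelopingAlgebra.lift ℂ ((UniversalEnvelopingAlgebra.ι ℂ).comp f.symm.toLieHom))
    (by
      apply UniversalEnvelopingAlgebra.hom_ext
      ext x
      simp [UniversalEnvelopingAlgebra.lift_ι_apply, -UniversalEnvelopingAlgebra.ι_apply])
    (by
      apply UniversalEnvelopingAlgebra.hom_ext
      ext x
      simp [UniversalEnvelopingAlgebra.lift_ι_apply, -UniversalEnvelopingAlgebra.ι_apply])

theorem uEquiv_ι (f : L ≃ₗ⁅ℂ⁆ L') (x : L) :
    uEquiv f (UniversalEnvelopingAlgebra.ι ℂ x) = UniversalEnvelopingAlgebra.ι ℂ (f x) :=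
  UniversalEnvelopingAlgebra.lift_ι_apply _ _ _

theorem linearMap_ext_cur {M : Type*} [AddCommGroup M] [Module ℂ M] {f g : Current L →ₗ[ℂ] M}
    (h : ∀ r x, f (cur r x) = g (cur r x)) : f = g := by
  apply TensorProduct.ext
  apply Polynomial.lhom_ext'
  intro r
  ext x
  simpa [cur, Polynomial.X_pow_eq_monomial] using h r x

theorem lie_cur (r s : ℕ) (x y : L) : ⁅cur r x, cur s y⁆ = cur (r + s) ⁅x, y⁆ := by
  rw [cur, cur, cur, LieAlgebra.ExtendScalars.bracket_tmul, pow_add]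

/-- The map `x ↦ x z^r` to `U(L[z])`. -/
noncomputable def ucurLin (r : ℕ) : L →ₗ[ℂ] UniversalEnvelopingAlgebra ℂ (Current L) :=
  (UniversalEnvelopingAlgebra.ι ℂ (L := Current L)).toLinearMap.comp
    (TensorProduct.mk ℂ ℂ[X] L (Polynomial.X ^ r))

theorem ucurLin_apply (r : ℕ) (x : L) : ucurLin r x = ucur r x := rfl

theorem isCurrentRep_ucurLin : IsCurrentRep (ucurLin : ℕ → L →ₗ[ℂ] _) := fun r s x y => by
  rw [ucurLin_apply, ucurLin_apply, ucurLin_apply, ucur, ucur, ucur, ← LieHom.map_lie, lie_cur]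

variable {A : Type*} [Ring A] [Algebra ℂ A]

/-- The linear map on the current algebra with `x z^r ↦ H_r x`. -/
noncomputable def curLin (H : ℕ → L →ₗ[ℂ] A) : Current L →ₗ[ℂ] A :=
  TensorProduct.lift ((Polynomial.basisMonomials ℂ).constr ℂ H)

theorem curLin_cur (H : ℕ → L →ₗ[ℂ] A) (r : ℕ) (x : L) : curLin H (cur r x) = H r x := by
  have h : (Polynomial.X : ℂ[X]) ^ r = Polynomial.basisMonomials ℂ r := by
    simp [Polynomial.X_pow_eq_monomial]
  rw [curLin, cur, TensorProduct.lift.tmul, h, Module.Basis.constr_basis]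

theorem curLin_lie {H : ℕ → L →ₗ[ℂ] A} (hH : IsCurrentRep H) (x y : Current L) :
    curLin H ⁅x, y⁆ = ⁅curLin H x, curLin H y⁆ := by
  let f₁ : Current L →ₗ[ℂ] Current L →ₗ[ℂ] A :=
    LinearMap.mk₂ ℂ (fun x y => curLin H ⁅x, y⁆)
      (fun x y z => (congrArg _ (add_lie x y z)).trans (map_add _ _ _))
      (fun a x y => (congrArg _ (smul_lie a x y)).trans (map_smul _ _ _))
      (fun x y z => (congrArg _ (lie_add x y z)).trans (map_add _ _ _))
      (fun a x y => (congrArg _ (lie_smul a x y)).trans (map_smul _ _ _))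
  let f₂ : Current L →ₗ[ℂ] Current L →ₗ[ℂ] A :=
    LinearMap.mk₂ ℂ (fun x y => ⁅curLin H x, curLin H y⁆)
      (fun _ _ _ => by rw [map_add, add_lie]) (fun _ _ _ => by rw [map_smul, smul_lie])
      (fun _ _ _ => by rw [map_add, lie_add]) (fun _ _ _ => by rw [map_smul, lie_smul])
  have h : f₁ = f₂ := linearMap_ext_cur fun r x => linearMap_ext_cur fun s y => by
    simp only [f₁, f₂, LinearMap.mk₂_apply, lie_cur, curLin_cur]
    exact (hH r s x y).symm
  exact congrArg (fun f => f x y) h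

/-- The homomorphism `U(L[z]) → A` given by a representation of `L[z]` in `A`. -/
theorem exists_hom_of_isCurrentRep {H : ℕ → L →ₗ[ℂ] A} (hH : IsCurrentRep H) :
    ∃ φ : UniversalEnvelopingAlgebra ℂ (Current L) →ₐ[ℂ] A, ∀ r x, φ (ucur r x) = H r x := by
  let f : Current L →ₗ⁅ℂ⁆ A := { curLin H with map_lie' := fun {x y} => curLin_lie hH x y }
  refine ⟨UniversalEnvelopingAlgebra.lift ℂ f, fun r x => ?_⟩
  rw [ucur, UniversalEnvelopingAlgebra.lift_ι_apply]
  exact curLin_cur H r x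

theorem map_cur (f : L →ₗ⁅ℂ⁆ L') (r : ℕ) (x : L) :
    LieAlgebra.ExtendScalars.map (AlgHom.id ℂ ℂ[X]) f (cur r x) = cur r (f x) := rfl

theorem map_map_cur {f : L →ₗ⁅ℂ⁆ L'} {g : L' →ₗ⁅ℂ⁆ L} (h : ∀ x, g (f x) = x) (x : Current L) :
    LieAlgebra.ExtendScalars.map (AlgHom.id ℂ ℂ[X]) g
      (LieAlgebra.ExtendScalars.map (AlgHom.id ℂ ℂ[X]) f x) = x := by
  have h1 : (LieAlgebra.ExtendScalars.map (AlgHom.id ℂ ℂ[X]) g).toLinearMap.comp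
      (LieAlgebra.ExtendScalars.map (AlgHom.id ℂ ℂ[X]) f).toLinearMap = LinearMap.id :=
    linearMap_ext_cur fun r y => by
      rw [LinearMap.comp_apply, LinearMap.id_apply, LieHom.coe_toLinearMap, LieHom.coe_toLinearMap,
        map_cur, map_cur, h]
  exact LinearMap.congr_fun h1 x

/-- The isomorphism of current algebras induced by an isomorphism of Lie algebras. -/
noncomputable def curEquiv (f : L ≃ₗ⁅ℂ⁆ L') : Current L ≃ₗ⁅ℂ⁆ Current L' :=
  { LieAlgebra.ExtendScalars.map (AlgHom.id ℂ ℂ[X]) f.toLieHom with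
    invFun := LieAlgebra.ExtendScalars.map (AlgHom.id ℂ ℂ[X]) f.symm.toLieHom
    left_inv := map_map_cur fun x => f.symm_apply_apply x
    right_inv := map_map_cur fun x => f.apply_symm_apply x }

theorem curEquiv_cur (f : L ≃ₗ⁅ℂ⁆ L') (r : ℕ) (x : L) : curEquiv f (cur r x) = cur r (f x) := rfl

end Enveloping

section Polynomials

open scoped IsMulCommutative in
/-- Commuting elements of an algebra give a homomorphism from the polynomial algebra. -/
theorem exists_mvPolynomial_hom {I A : Type*} [Ring A] [Algebra ℂ A] (k : I → A)
    (hk : ∀ l m, k l * k m = k m * k l) :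
    ∃ φ : MvPolynomial I ℂ →ₐ[ℂ] A, ∀ l, φ (MvPolynomial.X l) = k l := by
  have : IsMulCommutative (Algebra.adjoin ℂ (Set.range k)) :=
    Algebra.isMulCommutative_adjoin ℂ (by rintro _ ⟨l, rfl⟩ _ ⟨m, rfl⟩; exact hk l m)
  let g : I → Algebra.adjoin ℂ (Set.range k) := fun l => ⟨k l, Algebra.subset_adjoin ⟨l, rfl⟩⟩
  refine ⟨(Subalgebra.val _).comp (MvPolynomial.aeval g), fun l => ?_⟩
  simp [g]

end Polynomials

section Presentations

section FreeGenerators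

variable {ι A : Type*} [Ring A] [Algebra ℂ A]

theorem freeMat_map_lift (F : Matrix ι ι A) :
    (freeMat ι).map (FreeAlgebra.lift ℂ fun p : ι × ι => F p.1 p.2) = F := by
  ext i j
  simp [freeMat]

theorem freeSeq_map_lift (F : ℕ → Matrix ι ι A) :
    (fun r => (freeSeq ι r).map (FreeAlgebra.lift ℂ fun p : ι × ι × ℕ => F p.2.2 p.1 p.2.1)) =
      F := by
  ext r i j
  simp [freeSeq]

end FreeGenerators

variable {Λ ι : Type*} [Fintype Λ] [Fintype ι] [DecidableEq ι]
variable {A A' : Type*} [Ring A] [Algebra ℂ A] [Ring A'] [Algebra ℂ A']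

/-- The first relation of `U_ρ(𝔤)` and of `U_I(𝔤)`. -/
def BracketRel (P : Λ → Matrix ι ι ℂ) (F : Matrix ι ι A) : Prop :=
  ⁅mat₁ F, mat₂ F⁆ = ⁅scal A (tens P P), mat₂ F⁆

/-- The second relation of `U_I(𝔤)`. -/
def KRel (P Q : Λ → Matrix ι ι ℂ) (c : ℂ) (F : Matrix ι ι A) : Prop :=
  ⁅mat₂ (kMat P c F), scal A (tens P Q)⁆ = ⁅mat₁ (kMat P c F), scal A (tens Q P)⁆

theorem modeRel_const_iff {P Q : Λ → Matrix ι ι ℂ} {c : ℂ} {F : Matrix ι ι A} :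
    ModeRel P Q c (fun _ => F) ↔ BracketRel P F ∧ KRel P Q c F :=
  ⟨fun h => ⟨h.1 0 0, h.2 0⟩, fun h => ⟨fun _ _ => h.1, fun _ => h.2⟩⟩

theorem map_lie_mat₁_mat₂ (φ : A →ₐ[ℂ] A') (F : Matrix ι ι A) (p q : ι × ι) :
    φ (⁅mat₁ F, mat₂ F⁆ p q) = ⁅mat₁ (F.map φ), mat₂ (F.map φ)⁆ p q := by
  obtain ⟨i, k⟩ := p
  obtain ⟨j, l⟩ := q
  rw [lie_mat₁_mat₂_apply, lie_mat₁_mat₂_apply, Ring.lie_def, Ring.lie_def, map_sub, map_mul,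
    map_mul]
  rfl

theorem map_lie_tens_mat₂ (φ : A →ₐ[ℂ] A') (M : Matrix (ι × ι) (ι × ι) ℂ) (F : Matrix ι ι A)
    (p q : ι × ι) : φ (⁅scal A M, mat₂ F⁆ p q) = ⁅scal A' M, mat₂ (F.map φ)⁆ p q := by
  have h := map_lie_scal φ.toLinearMap M (mat₂ F)
  rw [map_mat₂] at h
  exact congrFun (congrFun h p) q

theorem map_lie_kMat_mat₂ (φ : A →ₐ[ℂ] A') (P : Λ → Matrix ι ι ℂ) (c : ℂ)
    (M : Matrix (ι × ι) (ι × ι) ℂ) (F : Matrix ι ι A) (p q : ι × ι) :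
    φ (⁅mat₂ (kMat P c F), scal A M⁆ p q) = ⁅mat₂ (kMat P c (F.map φ)), scal A' M⁆ p q := by
  have h := map_lie_scal_right φ.toLinearMap M (mat₂ (kMat P c F))
  rw [map_mat₂, map_kMat] at h
  exact congrFun (congrFun h p) q

theorem map_lie_kMat_mat₁ (φ : A →ₐ[ℂ] A') (P : Λ → Matrix ι ι ℂ) (c : ℂ)
    (M : Matrix (ι × ι) (ι × ι) ℂ) (F : Matrix ι ι A) (p q : ι × ι) :
    φ (⁅mat₁ (kMat P c F), scal A M⁆ p q) = ⁅mat₁ (kMat P c (F.map φ)), scal A' M⁆ p q := by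
  have h := map_lie_scal_right φ.toLinearMap M (mat₁ (kMat P c F))
  rw [map_mat₁, map_kMat] at h
  exact congrFun (congrFun h p) q

theorem UI.exists_lift {P Q : Λ → Matrix ι ι ℂ} {c : ℂ} {F : Matrix ι ι A}
    (h₁ : BracketRel P F) (h₂ : KRel P Q c F) :
    ∃ φ : UI P Q c →ₐ[ℂ] A, ∀ i j, φ (UI.F P Q c i j) = F i j := by
  let φ₀ := FreeAlgebra.lift ℂ fun p : ι × ι => F p.1 p.2
  have h : ∀ ⦃x y⦄, UIRel P Q c x y → φ₀ x = φ₀ y := by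
    rintro _ _ (⟨p, q⟩ | ⟨p, q⟩)
    · rw [map_lie_mat₁_mat₂, map_lie_tens_mat₂, freeMat_map_lift, h₁]
    · rw [map_lie_kMat_mat₂, map_lie_kMat_mat₁, freeMat_map_lift, h₂]
  refine ⟨RingQuot.liftAlgHom ℂ ⟨φ₀, h⟩, fun i j => ?_⟩
  refine (RingQuot.liftAlgHom_mkAlgHom_apply ℂ φ₀ h _).trans ?_
  simp [φ₀, freeMat]

theorem UI.hom_ext {P Q : Λ → Matrix ι ι ℂ} {c : ℂ} {φ ψ : UI P Q c →ₐ[ℂ] A}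
    (h : ∀ i j, φ (UI.F P Q c i j) = ψ (UI.F P Q c i j)) : φ = ψ := by
  apply RingQuot.ringQuot_ext'
  apply FreeAlgebra.hom_ext
  funext p
  exact h p.1 p.2

theorem UI.rel (P Q : Λ → Matrix ι ι ℂ) (c : ℂ) :
    BracketRel P (Matrix.of (UI.F P Q c)) ∧ KRel P Q c (Matrix.of (UI.F P Q c)) := by
  let φ : FreeAlgebra ℂ (ι × ι) →ₐ[ℂ] UI P Q c := RingQuot.mkAlgHom ℂ (UIRel P Q c)
  have hF : (freeMat ι).map φ = Matrix.of (UI.F P Q c) := rfl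
  have h : ∀ {x y}, UIRel P Q c x y → φ x = φ y := fun h => RingQuot.mkAlgHom_rel ℂ h
  constructor
  · ext p q
    rw [← hF, ← map_lie_mat₁_mat₂, ← map_lie_tens_mat₂]
    exact h (UIRel.bracket p q)
  · ext p q
    rw [← hF, ← map_lie_kMat_mat₂, ← map_lie_kMat_mat₁]
    exact h (UIRel.k p q)

theorem URho.exists_lift {P : Λ → Matrix ι ι ℂ} {c : ℂ} {F : Matrix ι ι A}
    (h₁ : BracketRel P F) (h₂ : kMat P c F = 0) :
    ∃ φ : URho P c →ₐ[ℂ] A, ∀ i j, φ (URho.F P c i j) = F i j := by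
  let φ₀ := FreeAlgebra.lift ℂ fun p : ι × ι => F p.1 p.2
  have h : ∀ ⦃x y⦄, URhoRel P c x y → φ₀ x = φ₀ y := by
    rintro _ _ (⟨p, q⟩ | ⟨i, j⟩)
    · rw [map_lie_mat₁_mat₂, map_lie_tens_mat₂, freeMat_map_lift, h₁]
    · have h3 := map_kMat φ₀.toLinearMap P c (freeMat ι)
      have h4 : (freeMat ι).map φ₀.toLinearMap = F := freeMat_map_lift F
      rw [h4, h₂] at h3
      have h5 := congrFun (congrFun h3 i) j
      rw [← sub_eq_zero, ← map_sub]
      exact h5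
  refine ⟨RingQuot.liftAlgHom ℂ ⟨φ₀, h⟩, fun i j => ?_⟩
  refine (RingQuot.liftAlgHom_mkAlgHom_apply ℂ φ₀ h _).trans ?_
  simp [φ₀, freeMat]

theorem URho.hom_ext {P : Λ → Matrix ι ι ℂ} {c : ℂ} {φ ψ : URho P c →ₐ[ℂ] A}
    (h : ∀ i j, φ (URho.F P c i j) = ψ (URho.F P c i j)) : φ = ψ := by
  apply RingQuot.ringQuot_ext'
  apply FreeAlgebra.hom_ext
  funext p
  exact h p.1 p.2

theorem URho.rel (P : Λ → Matrix ι ι ℂ) (c : ℂ) :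
    BracketRel P (Matrix.of (URho.F P c)) ∧ kMat P c (Matrix.of (URho.F P c)) = 0 := by
  let φ : FreeAlgebra ℂ (ι × ι) →ₐ[ℂ] URho P c := RingQuot.mkAlgHom ℂ (URhoRel P c)
  have hF : (freeMat ι).map φ = Matrix.of (URho.F P c) := rfl
  have h : ∀ {x y}, URhoRel P c x y → φ x = φ y := fun h => RingQuot.mkAlgHom_rel ℂ h
  constructor
  · ext p q
    rw [← hF, ← map_lie_mat₁_mat₂, ← map_lie_tens_mat₂]
    exact h (URhoRel.bracket p q)
  · rw [← hF]
    refine (map_kMat φ.toLinearMap P c (freeMat ι)).symm.trans ?_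
    ext i j
    refine (map_sub φ _ _).trans ?_
    exact sub_eq_zero.mpr (h (URhoRel.casimir i j))

theorem RMatAlg.exists_lift {P Q : Λ → Matrix ι ι ℂ} {c : ℂ} {F : ℕ → Matrix ι ι A}
    (hF : ModeRel P Q c F) :
    ∃ φ : RMatAlg P Q c →ₐ[ℂ] A, ∀ r i j, φ (RMatAlg.F P Q c r i j) = F r i j := by
  let φ₀ := FreeAlgebra.lift ℂ fun p : ι × ι × ℕ => F p.2.2 p.1 p.2.1
  obtain ⟨h₁, h₂⟩ := (modeRel_iff P Q c F).mp hF
  have h : ∀ ⦃x y⦄, RMatRel P Q c x y → φ₀ x = φ₀ y := by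
    rintro _ _ (⟨p, q, n, m⟩ | ⟨p, q, n⟩)
    · rw [← coeffUV_apply, ← coeffUV_apply, map_coeff_rLeft, map_coeff_rRight, freeSeq_map_lift, h₁]
    · rw [← coeffU_apply, ← coeffU_apply, map_coeff_kLeft, map_coeff_kRight, freeSeq_map_lift, h₂]
  refine ⟨RingQuot.liftAlgHom ℂ ⟨φ₀, h⟩, fun r i j => ?_⟩
  refine (RingQuot.liftAlgHom_mkAlgHom_apply ℂ φ₀ h _).trans ?_
  simp [φ₀, freeSeq]

theorem RMatAlg.hom_ext {P Q : Λ → Matrix ι ι ℂ} {c : ℂ} {φ ψ : RMatAlg P Q c →ₐ[ℂ] A}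
    (h : ∀ r i j, φ (RMatAlg.F P Q c r i j) = ψ (RMatAlg.F P Q c r i j)) : φ = ψ := by
  apply RingQuot.ringQuot_ext'
  apply FreeAlgebra.hom_ext
  funext p
  exact h p.2.2 p.1 p.2.1

theorem RMatAlg.rel (P Q : Λ → Matrix ι ι ℂ) (c : ℂ) :
    ModeRel P Q c fun r => Matrix.of (RMatAlg.F P Q c r) := by
  let φ : FreeAlgebra ℂ (ι × ι × ℕ) →ₐ[ℂ] RMatAlg P Q c := RingQuot.mkAlgHom ℂ (RMatRel P Q c)
  have hF : (fun r => (freeSeq ι r).map φ) = fun r => Matrix.of (RMatAlg.F P Q c r) := rfl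
  have h : ∀ {x y}, RMatRel P Q c x y → φ x = φ y := fun h => RingQuot.mkAlgHom_rel ℂ h
  rw [modeRel_iff, ← hF]
  constructor
  · refine Matrix.ext fun p q => eq_of_coeffUV_eq (A := RMatAlg P Q c) fun n m => ?_
    rw [← map_coeff_rLeft, ← map_coeff_rRight]
    exact h (RMatRel.r p q n m)
  · refine Matrix.ext fun p q => PowerSeries.ext fun n => ?_
    rw [← coeffU_apply, ← coeffU_apply, ← map_coeff_kLeft, ← map_coeff_kRight]
    exact h (RMatRel.k p q n)

end Presentations

/-! ### The isomorphisms for a representation in matrix form -/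

theorem commute_of_adjoin_eq_top {A C : Type*} [Ring A] [Algebra ℂ A] [Ring C] [Algebra ℂ C]
    {φ : A →ₐ[ℂ] C} {s : Set A} {a : C} (hs : Algebra.adjoin ℂ s = ⊤)
    (h : ∀ x ∈ s, Commute (φ x) a) (x : A) : Commute (φ x) a := by
  have hle : Algebra.adjoin ℂ s ≤ (Subalgebra.centralizer ℂ {a}).comap φ :=
    Algebra.adjoin_le fun z hz => by
      rw [SetLike.mem_coe, Subalgebra.mem_comap, Subalgebra.mem_centralizer_iff]
      rintro _ rfl
      exact (h z hz).symm
  have hx : x ∈ Algebra.adjoin ℂ s := hs ▸ Algebra.mem_top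
  exact ((Subalgebra.mem_centralizer_iff ℂ).mp (hle hx) _ rfl).symm

theorem adjoin_mkAlgHom_eq_top {G : Type*} (r : FreeAlgebra ℂ G → FreeAlgebra ℂ G → Prop) :
    Algebra.adjoin ℂ (Set.range fun x => RingQuot.mkAlgHom ℂ r (FreeAlgebra.ι ℂ x)) = ⊤ := by
  have h : (Set.range fun x => RingQuot.mkAlgHom ℂ r (FreeAlgebra.ι ℂ x)) =
      RingQuot.mkAlgHom ℂ r '' Set.range (FreeAlgebra.ι ℂ) := Set.range_comp _ _
  rw [h, ← AlgHom.map_adjoin, FreeAlgebra.adjoin_range_ι, Algebra.map_top,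
    AlgHom.range_eq_top]
  exact RingQuot.mkAlgHom_surjective ℂ r

theorem URho.adjoin_range_F {Λ ι : Type*} [Fintype Λ] [Fintype ι] [DecidableEq ι]
    (P : Λ → Matrix ι ι ℂ) (c : ℂ) :
    Algebra.adjoin ℂ (Set.range fun u : ι × ι => URho.F P c u.1 u.2) = ⊤ :=
  adjoin_mkAlgHom_eq_top (URhoRel P c)

section Isomorphisms

variable {𝔤 : Type*} [LieRing 𝔤] [LieAlgebra ℂ 𝔤] {Λ ι I : Type*} [Fintype Λ]
  [DecidableEq Λ] [Fintype ι] [DecidableEq ι] {B : LinearMap.BilinForm ℂ 𝔤}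
  {X : Module.Basis Λ ℂ 𝔤} {c : ℂ}
  {p : 𝔤 →ₗ⁅ℂ⁆ Matrix ι ι ℂ} {q : 𝔤 →ₗ[ℂ] Matrix ι ι ℂ} {S : I → Matrix ι ι ℂ}
  {A : Type*} [Ring A] [Algebra ℂ A]

/-- The enveloping algebra contains `𝔤 ⊕ 𝔷_I`: the adjoint representation separates the points of
`𝔤`, and the representation by linear polynomials those of `𝔷_I`. -/
theorem ι_prod_abelianLie_injective [LieAlgebra.IsSimple ℂ 𝔤] :
    Function.Injective (UniversalEnvelopingAlgebra.ι ℂ (L := 𝔤 × AbelianLie I)) := by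
  rw [injective_iff_map_eq_zero]
  rintro ⟨x, z⟩ h
  let f₁ : 𝔤 × AbelianLie I →ₗ⁅ℂ⁆ Module.End ℂ 𝔤 :=
    (LieAlgebra.ad ℂ 𝔤).comp (LieHom.fst ℂ 𝔤 (AbelianLie I))
  let g : AbelianLie I →ₗ[ℂ] MvPolynomial I ℂ :=
    (AbelianLie.basis I).constr ℂ MvPolynomial.X
  let f₂ : 𝔤 × AbelianLie I →ₗ⁅ℂ⁆ MvPolynomial I ℂ :=
    { g.comp (LinearMap.snd ℂ 𝔤 (AbelianLie I)) with
      map_lie' := fun {x y} => by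
        rw [LieRing.of_associative_ring_bracket, mul_comm, sub_self]
        exact map_zero g }
  have h₁ := congrArg (UniversalEnvelopingAlgebra.lift ℂ f₁) h
  have h₂ := congrArg (UniversalEnvelopingAlgebra.lift ℂ f₂) h
  rw [UniversalEnvelopingAlgebra.lift_ι_apply, map_zero] at h₁ h₂
  have hx : x = 0 := by
    have hker : x ∈ (LieAlgebra.ad ℂ 𝔤).ker := h₁
    rwa [LieAlgebra.ad_ker_eq_bot_of_hasTrivialRadical, LieSubmodule.mem_bot] at hker
  have hz : z = 0 := by
    have hg : g z = 0 := h₂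
    have hli : LinearIndependent ℂ (MvPolynomial.X : I → MvPolynomial I ℂ) :=
      MvPolynomial.linearIndependent_X I ℂ
    have hinj : Function.Injective g :=
      (AbelianLie.basis I).injective_constr_of_linearIndependent hli
    exact hinj (hg.trans (map_zero g).symm)
  rw [hx, hz]
  rfl

theorem isCurrentRep_const {L : Type*} [LieRing L] [LieAlgebra ℂ L] {f : L →ₗ[ℂ] A}
    (hf : ∀ x y, ⁅f x, f y⁆ = f ⁅x, y⁆) : IsCurrentRep fun _ : ℕ => f := fun _ _ => hf

namespace IsMatrixRep

variable [Fintype I] (hR : IsMatrixRep B X c p q S)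

include hR

/-- The entries of `-(ρ ⊗ 1)(Ω) + 𝒦` span `𝔤 ⊕ 𝔷_I`: a functional vanishing on them vanishes on
`𝔤` and on `𝔷_I`, because the `p (X l)`, as well as the `S l`, are linearly independent, and `kMat`
separates the two summands. -/
theorem span_genEl :
    Submodule.span ℂ (Set.range fun u : ι × ι => genEl X (fun l => p (X l)) S u.1 u.2) = ⊤ := by
  by_contra hne
  obtain ⟨f, hf0, hf⟩ := Submodule.exists_le_ker_of_lt_top _ (lt_top_iff_ne_top.mpr hne)
  apply hf0
  have h0 : (Matrix.of fun i j => f (genEl X (fun l => p (X l)) S i j)) = 0 := by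
    ext i j
    exact hf (Submodule.subset_span ⟨(i, j), rfl⟩)
  have h1 := hR.kMat_genEl f
  rw [h0, ← kLin_apply _ _ (0 : Matrix ι ι ℂ), map_zero] at h1
  have h2 : (fun l => f (0, AbelianLie.K l)) = 0 :=
    comb_injective hR.S_indep (h1.symm.trans (map_zero _).symm)
  have h3 := apply_genEl X (fun l => p (X l)) S f
  rw [h0, ← h1, zero_sub, eq_comm, neg_eq_zero] at h3
  have h4 : (fun l => f (X l, 0)) = 0 := comb_injective hR.indep_p (h3.trans (map_zero _).symm)
  apply LinearMap.prod_ext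
  · exact X.ext fun l => congrFun h4 l
  · exact (AbelianLie.basis I).ext fun l => by
      rw [AbelianLie.basis_apply]
      exact congrFun h2 l

theorem linearMap_ext_genEl {M : Type*} [AddCommGroup M] [Module ℂ M]
    {f g : 𝔤 × AbelianLie I →ₗ[ℂ] M}
    (h : ∀ i j, f (genEl X (fun l => p (X l)) S i j) = g (genEl X (fun l => p (X l)) S i j)) :
    f = g :=
  LinearMap.ext_on_range hR.span_genEl fun u => h u.1 u.2

/-- The relations of `U_I(𝔤)` hold in `A` for the images of the entries of `-(ρ ⊗ 1)(Ω) + 𝒦`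
under a homomorphism of Lie algebras. -/
theorem rel_genEl {f : 𝔤 × AbelianLie I →ₗ[ℂ] A} (hf : ∀ x y, ⁅f x, f y⁆ = f ⁅x, y⁆) :
    BracketRel (fun l => p (X l)) (Matrix.of fun i j => f (genEl X (fun l => p (X l)) S i j)) ∧
      KRel (fun l => p (X l)) (fun l => q (X l)) c
        (Matrix.of fun i j => f (genEl X (fun l => p (X l)) S i j)) :=
  modeRel_const_iff.mp (hR.modeRel_of_isCurrentRep (isCurrentRep_const hf))

/-- Every solution of the relations of `U_I(𝔤)` in `A` comes from a homomorphism of Lie algebras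
from `𝔤 ⊕ 𝔷_I` to `A`. -/
theorem exists_lieHom [LieAlgebra.IsSimple ℂ 𝔤] {F : Matrix ι ι A}
    (h₁ : BracketRel (fun l => p (X l)) F) (h₂ : KRel (fun l => p (X l)) (fun l => q (X l)) c F) :
    ∃ f : 𝔤 × AbelianLie I →ₗ⁅ℂ⁆ A, ∀ i j, F i j = f (genEl X (fun l => p (X l)) S i j) := by
  obtain ⟨H, hH, hF⟩ := hR.exists_isCurrentRep (modeRel_const_iff.mpr ⟨h₁, h₂⟩)
  exact ⟨{ H 0 with map_lie' := fun {x y} => (hH 0 0 x y).symm },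
    fun i j => congrFun (congrFun (hF 0) i) j⟩

/-- `U_ρ(𝔤) ≅ U(𝔤)`. -/
theorem exists_URho_equiv [LieAlgebra.IsSimple ℂ 𝔤] :
    ∃ φ : URho (fun l => p (X l)) c ≃ₐ[ℂ] UniversalEnvelopingAlgebra ℂ 𝔤, ∀ i j,
      φ (URho.F (fun l => p (X l)) c i j) =
        -∑ l, p (X l) i j • UniversalEnvelopingAlgebra.ι ℂ (X l) := by
  obtain ⟨h₁, h₂⟩ := URho.rel (fun l => p (X l)) c
  have hK : KRel (fun l => p (X l)) (fun l => q (X l)) c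
      (Matrix.of (URho.F (fun l => p (X l)) c)) := by
    rw [KRel, h₂]
    simp [mat₁, mat₂]
  obtain ⟨f, hf⟩ := hR.exists_lieHom h₁ hK
  have hf' : Matrix.of (URho.F (fun l => p (X l)) c) =
      Matrix.of fun i j => f.toLinearMap (genEl X (fun l => p (X l)) S i j) := by
    ext i j; exact hf i j
  have hfF : Matrix.of (URho.F (fun l => p (X l)) c) =
      -comb _ (fun l => p (X l)) fun l => f (X l, 0) := by
    have h3 := h₂
    rw [hf', hR.kMat_genEl] at h3
    rw [hf', apply_genEl, h3, zero_sub]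
    rfl
  let U := UniversalEnvelopingAlgebra ℂ 𝔤
  let g : 𝔤 × AbelianLie I →ₗ⁅ℂ⁆ U :=
    (UniversalEnvelopingAlgebra.ι ℂ).comp (LieHom.fst ℂ 𝔤 (AbelianLie I))
  have hgK : ∀ l, g.toLinearMap (0, AbelianLie.K l) = 0 := fun l =>
    map_zero (UniversalEnvelopingAlgebra.ι ℂ : 𝔤 →ₗ⁅ℂ⁆ U)
  have hg : (Matrix.of fun i j => g.toLinearMap (genEl X (fun l => p (X l)) S i j)) =
      -comb _ (fun l => p (X l)) fun l => UniversalEnvelopingAlgebra.ι ℂ (X l) := by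
    rw [apply_genEl, funext hgK, ← Pi.zero_def, map_zero, zero_sub]
    rfl
  obtain ⟨φ, hφ⟩ := URho.exists_lift (hR.rel_genEl (f := g.toLinearMap) fun x y =>
    (g.map_lie x y).symm).1 (by rw [hR.kMat_genEl, funext hgK, ← Pi.zero_def, map_zero])
  rw [hg] at hφ
  let ψ : U →ₐ[ℂ] URho (fun l => p (X l)) c :=
    UniversalEnvelopingAlgebra.lift ℂ (f.comp (LieHom.inl ℂ 𝔤 (AbelianLie I)))
  have hψ : ∀ x, ψ (UniversalEnvelopingAlgebra.ι ℂ x) = f (x, 0) := fun x =>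
    UniversalEnvelopingAlgebra.lift_ι_apply _ _ _
  have hφ' : ∀ i j, φ (URho.F (fun l => p (X l)) c i j) =
      -∑ l, p (X l) i j • UniversalEnvelopingAlgebra.ι ℂ (X l) := fun i j => by
    rw [hφ, Matrix.neg_apply, comb_apply]
  have hF : ∀ i j, URho.F (fun l => p (X l)) c i j = -∑ l, p (X l) i j • f (X l, 0) := fun i j => by
    have := congrFun (congrFun hfF i) j
    rwa [Matrix.neg_apply, comb_apply] at this
  refine ⟨AlgEquiv.ofAlgHom φ ψ ?_ ?_, hφ'⟩
  · have h4 : comb U (fun l => p (X l)) (fun l => φ (f (X l, 0))) =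
        comb U (fun l => p (X l)) fun l => UniversalEnvelopingAlgebra.ι ℂ (X l) := by
      ext i j
      have h5 := hφ' i j
      rw [hF, map_neg, map_sum, neg_inj] at h5
      simp only [map_smul] at h5
      rw [comb_apply, comb_apply, h5]
    have h6 := comb_injective hR.indep_p h4
    have h7 : (φ.toLinearMap.comp f.toLinearMap).comp (LinearMap.inl ℂ 𝔤 (AbelianLie I)) =
        (UniversalEnvelopingAlgebra.ι ℂ : 𝔤 →ₗ⁅ℂ⁆ U).toLinearMap :=
      X.ext fun l => congrFun h6 l
    apply UniversalEnvelopingAlgebra.hom_ext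
    ext x
    refine (congrArg φ (hψ x)).trans ?_
    exact LinearMap.congr_fun h7 x
  · refine URho.hom_ext fun i j => ?_
    rw [AlgHom.comp_apply, hφ', map_neg, map_sum, AlgHom.id_apply, hF]
    simp only [map_smul, hψ]

/-- `U_I(𝔤) ≅ ℂ[𝒦_l : l ∈ I] ⊗ U_ρ(𝔤)`: both sides receive `𝔤 ⊕ 𝔷_I`, and the images of `𝔤` and
of `𝔷_I` commute. -/
theorem exists_UI_equiv_tensor [LieAlgebra.IsSimple ℂ 𝔤] :
    ∃ φ : UI (fun l => p (X l)) (fun l => q (X l)) c ≃ₐ[ℂ]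
        MvPolynomial I ℂ ⊗[ℂ] URho (fun l => p (X l)) c, ∀ i j,
      φ (UI.F (fun l => p (X l)) (fun l => q (X l)) c i j) =
        1 ⊗ₜ[ℂ] URho.F (fun l => p (X l)) c i j + (∑ l, S l i j • MvPolynomial.X l) ⊗ₜ[ℂ] 1 := by
  obtain ⟨φ₁, hφ₁⟩ := hR.exists_URho_equiv
  obtain ⟨h₁, h₂⟩ := UI.rel (fun l => p (X l)) (fun l => q (X l)) c
  obtain ⟨f, hf⟩ := hR.exists_lieHom h₁ h₂
  let h : 𝔤 →ₗ[ℂ] URho (fun l => p (X l)) c :=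
    φ₁.symm.toLinearMap.comp (UniversalEnvelopingAlgebra.ι ℂ (L := 𝔤)).toLinearMap
  have hh : ∀ x y, ⁅h x, h y⁆ = h ⁅x, y⁆ := fun x y => by
    change _ = φ₁.symm (UniversalEnvelopingAlgebra.ι ℂ ⁅x, y⁆)
    rw [LieHom.map_lie, Ring.lie_def, Ring.lie_def, map_sub, map_mul, map_mul]
    rfl
  have hF : ∀ i j, URho.F (fun l => p (X l)) c i j = -∑ l, p (X l) i j • h (X l) := fun i j => by
    rw [← φ₁.symm_apply_apply (URho.F _ c i j), hφ₁, map_neg, map_sum]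
    simp only [map_smul]
    rfl
  let k : AbelianLie I →ₗ[ℂ] MvPolynomial I ℂ := (AbelianLie.basis I).constr ℂ MvPolynomial.X
  have hk : ∀ l, k (AbelianLie.K l) = MvPolynomial.X l := fun l => by
    rw [← AbelianLie.basis_apply]
    exact Module.Basis.constr_basis _ _ _ _
  let g : 𝔤 × AbelianLie I →ₗ[ℂ] MvPolynomial I ℂ ⊗[ℂ] URho (fun l => p (X l)) c :=
    (TensorProduct.mk ℂ _ _ 1).comp (h.comp (LinearMap.fst ℂ 𝔤 (AbelianLie I))) +
      ((TensorProduct.mk ℂ _ _).flip 1).comp (k.comp (LinearMap.snd ℂ 𝔤 (AbelianLie I)))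
  have hg : ∀ x z, g (x, z) = 1 ⊗ₜ h x + k z ⊗ₜ 1 := fun x z => rfl
  have hg' : ∀ x y, g x * g y - g y * g x = g ⁅x, y⁆ := by
    rintro ⟨x, z⟩ ⟨y, w⟩
    change _ = g (⁅x, y⁆, 0)
    rw [hg, hg, hg, ← hh, Ring.lie_def, map_zero, TensorProduct.zero_tmul, add_zero,
      TensorProduct.tmul_sub]
    simp only [mul_add, add_mul, Algebra.TensorProduct.tmul_mul_tmul, one_mul, mul_one,
      mul_comm (k w)]
    abel
  have hgF : ∀ i j, g (genEl X (fun l => p (X l)) S i j) =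
      1 ⊗ₜ[ℂ] URho.F (fun l => p (X l)) c i j +
        (∑ l, S l i j • MvPolynomial.X l) ⊗ₜ[ℂ] 1 := fun i j => by
    rw [genEl, hg, hF, map_neg, map_sum, map_sum]
    simp only [map_smul, hk]
  have hrel := hR.rel_genEl (f := g) fun x y => (Ring.lie_def _ _).trans (hg' x y)
  obtain ⟨φ, hφ⟩ := UI.exists_lift hrel.1 hrel.2
  have hφf : φ.toLinearMap.comp f.toLinearMap = g :=
    hR.linearMap_ext_genEl fun i j => (congrArg φ (hf i j).symm).trans (hφ i j)
  have hcomm : ∀ x z, Commute (f (0, z)) (f (x, 0)) := fun x z => by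
    rw [commute_iff_lie_eq, ← LieHom.map_lie]
    have h0 : ⁅((0 : 𝔤), z), (x, (0 : AbelianLie I))⁆ = 0 :=
      Prod.ext (zero_lie x) (lie_zero z)
    rw [h0, map_zero]
  obtain ⟨ψ₁, hψ₁⟩ := exists_mvPolynomial_hom (fun l => f (0, AbelianLie.K l)) fun l m => by
    rw [← sub_eq_zero, ← Ring.lie_def, ← LieHom.map_lie]
    have h0 : ⁅((0 : 𝔤), AbelianLie.K l), ((0 : 𝔤), AbelianLie.K m)⁆ = 0 :=
      Prod.ext (zero_lie _) rfl
    rw [h0, map_zero]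
  let ψ₂ : URho (fun l => p (X l)) c →ₐ[ℂ] UI (fun l => p (X l)) (fun l => q (X l)) c :=
    (UniversalEnvelopingAlgebra.lift ℂ (f.comp (LieHom.inl ℂ 𝔤 (AbelianLie I)))).comp φ₁
  have hψ₂ : ∀ x, ψ₂ (h x) = f (x, 0) := fun x => by
    have h3 : φ₁ (h x) = UniversalEnvelopingAlgebra.ι ℂ x := φ₁.apply_symm_apply _
    exact (congrArg _ h3).trans (UniversalEnvelopingAlgebra.lift_ι_apply _ _ _)
  have hψ₂F : ∀ i j, ψ₂ (URho.F (fun l => p (X l)) c i j) =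
      -∑ l, p (X l) i j • f (X l, 0) := fun i j => by
    rw [hF, map_neg, map_sum]
    simp only [map_smul, hψ₂]
  have hψ : ∀ a u, Commute (ψ₁ a) (ψ₂ u) := by
    intro a u
    refine commute_of_adjoin_eq_top MvPolynomial.adjoin_range_X ?_ a
    rintro _ ⟨l, rfl⟩
    refine (commute_of_adjoin_eq_top (URho.adjoin_range_F _ c) ?_ u).symm
    rintro _ ⟨⟨i, j⟩, rfl⟩
    refine Commute.symm ?_
    rw [hψ₁, hψ₂F]
    exact (Commute.sum_right _ _ _ fun m _ => (hcomm _ _).smul_right _).neg_right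
  let ψ := Algebra.TensorProduct.lift ψ₁ ψ₂ hψ
  have hψt : ∀ a u, ψ (a ⊗ₜ u) = ψ₁ a * ψ₂ u := fun a u =>
    Algebra.TensorProduct.lift_tmul _ _ _ _ _
  refine ⟨AlgEquiv.ofAlgHom φ ψ ?_ ?_, fun i j => (hφ i j).trans (hgF i j)⟩
  · have hφf' : ∀ x, φ (f x) = g x := fun x => LinearMap.congr_fun hφf x
    apply Algebra.TensorProduct.ext
    · refine MvPolynomial.algHom_ext fun l => ?_
      change φ (ψ (MvPolynomial.X l ⊗ₜ 1)) = MvPolynomial.X l ⊗ₜ 1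
      rw [hψt, map_one, mul_one, hψ₁, hφf', hg, map_zero, TensorProduct.tmul_zero, zero_add, hk]
    · refine URho.hom_ext fun i j => ?_
      change φ (ψ (1 ⊗ₜ URho.F (fun l => p (X l)) c i j)) =
        1 ⊗ₜ URho.F (fun l => p (X l)) c i j
      rw [hψt, map_one, one_mul, hψ₂F, hF, map_neg, map_sum, TensorProduct.tmul_neg,
        TensorProduct.tmul_sum]
      simp only [map_smul, hφf', hg, map_zero, TensorProduct.zero_tmul, add_zero,
        TensorProduct.tmul_smul]
  · refine UI.hom_ext fun i j => ?_
    change ψ (φ _) = _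
    rw [hφ, Matrix.of_apply, hgF, map_add, hψt, hψt, map_one, map_one, one_mul, mul_one, hψ₂F,
      map_sum]
    simp only [map_smul, hψ₁]
    have h4 := congrFun (congrFun (apply_genEl X (fun l => p (X l)) S f.toLinearMap) i) j
    rw [Matrix.sub_apply, comb_apply, comb_apply, sub_eq_neg_add] at h4
    exact h4.symm.trans (hf i j).symm

/-- `U_I(𝔤) ≅ U(𝔤 ⊕ 𝔷_I)`. -/
theorem exists_UI_equiv [LieAlgebra.IsSimple ℂ 𝔤] :
    ∃ φ : UI (fun l => p (X l)) (fun l => q (X l)) c ≃ₐ[ℂ]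
        UniversalEnvelopingAlgebra ℂ (𝔤 × AbelianLie I), ∀ i j,
      φ (UI.F (fun l => p (X l)) (fun l => q (X l)) c i j) =
        UniversalEnvelopingAlgebra.ι ℂ (genEl X (fun l => p (X l)) S i j) := by
  obtain ⟨h₁, h₂⟩ := UI.rel (fun l => p (X l)) (fun l => q (X l)) c
  obtain ⟨f, hf⟩ := hR.exists_lieHom h₁ h₂
  have hr := hR.rel_genEl
    (f := (UniversalEnvelopingAlgebra.ι ℂ (L := 𝔤 × AbelianLie I)).toLinearMap)
    fun x y => (LieHom.map_lie _ x y).symm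
  obtain ⟨φ, hφ⟩ := UI.exists_lift hr.1 hr.2
  let ψ := UniversalEnvelopingAlgebra.lift ℂ f
  have hψ : ∀ x, ψ (UniversalEnvelopingAlgebra.ι ℂ x) = f x := fun x =>
    UniversalEnvelopingAlgebra.lift_ι_apply _ _ _
  have hφψ : φ.toLinearMap.comp f.toLinearMap =
      (UniversalEnvelopingAlgebra.ι ℂ (L := 𝔤 × AbelianLie I)).toLinearMap :=
    hR.linearMap_ext_genEl fun i j => (congrArg φ (hf i j).symm).trans (hφ i j)
  refine ⟨AlgEquiv.ofAlgHom φ ψ ?_ ?_, hφ⟩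
  · apply UniversalEnvelopingAlgebra.hom_ext
    refine LieHom.ext fun x => ?_
    exact (congrArg φ (hψ x)).trans (LinearMap.congr_fun hφψ x)
  · refine UI.hom_ext fun i j => ?_
    exact (congrArg ψ (hφ i j)).trans ((hψ _).trans (hf i j).symm)

/-- `𝔤_I ≅ 𝔤 ⊕ 𝔷_I`, and `U(𝔤_I) ≅ U_I(𝔤)`: the isomorphism `U_I(𝔤) ≅ U(𝔤 ⊕ 𝔷_I)` identifies
`𝔤_I` with the image of `𝔤 ⊕ 𝔷_I` in its enveloping algebra. -/
theorem exists_gI_equiv [LieAlgebra.IsSimple ℂ 𝔤] :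
    (∃ φ : gI (fun l => p (X l)) (fun l => q (X l)) c ≃ₗ⁅ℂ⁆ 𝔤 × AbelianLie I, ∀ i j,
      φ (gI.F (fun l => p (X l)) (fun l => q (X l)) c i j) =
        genEl X (fun l => p (X l)) S i j) ∧
    Function.Bijective
      (UniversalEnvelopingAlgebra.lift ℂ (gI (fun l => p (X l)) (fun l => q (X l)) c).incl) := by
  obtain ⟨Φ, hΦ⟩ := hR.exists_UI_equiv
  obtain ⟨h₁, h₂⟩ := UI.rel (fun l => p (X l)) (fun l => q (X l)) c
  obtain ⟨f, hf⟩ := hR.exists_lieHom h₁ h₂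
  have hΦf' : Φ.toLinearMap.comp f.toLinearMap =
      (UniversalEnvelopingAlgebra.ι ℂ (L := 𝔤 × AbelianLie I)).toLinearMap :=
    hR.linearMap_ext_genEl fun i j => (congrArg Φ (hf i j).symm).trans (hΦ i j)
  have hΦf : ∀ x, Φ (f x) = UniversalEnvelopingAlgebra.ι ℂ x := fun x => LinearMap.congr_fun hΦf' x
  have hinj : Function.Injective f := fun x y hxy =>
    ι_prod_abelianLie_injective (by rw [← hΦf, ← hΦf, hxy])
  have hrange : f.range = gI (fun l => p (X l)) (fun l => q (X l)) c := by
    apply le_antisymm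
    · rintro _ ⟨x, rfl⟩
      have hx : x ∈ Submodule.span ℂ
          (Set.range fun u : ι × ι => genEl X (fun l => p (X l)) S u.1 u.2) := by
        rw [hR.span_genEl]; exact Submodule.mem_top
      have hle : Submodule.span ℂ
          (Set.range fun u : ι × ι => genEl X (fun l => p (X l)) S u.1 u.2) ≤
          (gI (fun l => p (X l)) (fun l => q (X l)) c).toSubmodule.comap f.toLinearMap := by
        rw [Submodule.span_le]
        rintro _ ⟨⟨i, j⟩, rfl⟩
        have hmem := (gI.F (fun l => p (X l)) (fun l => q (X l)) c i j).2
        rw [show (gI.F (fun l => p (X l)) (fun l => q (X l)) c i j :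
          UI (fun l => p (X l)) (fun l => q (X l)) c) = _ from hf i j] at hmem
        exact hmem
      exact hle hx
    · rw [gI, LieSubalgebra.lieSpan_le]
      rintro _ ⟨⟨i, j⟩, rfl⟩
      exact ⟨_, (hf i j).symm⟩
  let θ : (𝔤 × AbelianLie I) ≃ₗ⁅ℂ⁆ gI (fun l => p (X l)) (fun l => q (X l)) c :=
    (LieEquiv.ofInjective f hinj).trans (LieEquiv.ofEq _ _ (congrArg _ hrange))
  have hθ : ∀ x, (θ x : UI (fun l => p (X l)) (fun l => q (X l)) c) = f x := fun x => rfl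
  refine ⟨⟨θ.symm, fun i j => ?_⟩, ?_⟩
  · rw [LieEquiv.symm_apply_eq]
    exact Subtype.ext (hf i j)
  · have h : UniversalEnvelopingAlgebra.lift ℂ (gI (fun l => p (X l)) (fun l => q (X l)) c).incl =
        ((uEquiv θ.symm).trans Φ.symm : _ →ₐ[ℂ] _) := by
      apply UniversalEnvelopingAlgebra.hom_ext
      refine LieHom.ext fun x => (UniversalEnvelopingAlgebra.lift_ι_apply _ _ _).trans ?_
      change _ = Φ.symm (uEquiv θ.symm (UniversalEnvelopingAlgebra.ι ℂ x))
      rw [uEquiv_ι, ← hΦf, Φ.symm_apply_apply, ← hθ, θ.apply_symm_apply]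
      rfl
    rw [h]
    exact ((uEquiv θ.symm).trans Φ.symm).bijective

/-- `U((𝔤 ⊕ 𝔷_I)[z])` is presented by the `r`-matrix relations. -/
theorem exists_RMatAlg_equiv [LieAlgebra.IsSimple ℂ 𝔤] :
    ∃ φ : RMatAlg (fun l => p (X l)) (fun l => q (X l)) c ≃ₐ[ℂ]
        UniversalEnvelopingAlgebra ℂ (Current (𝔤 × AbelianLie I)), ∀ r i j,
      φ (RMatAlg.F (fun l => p (X l)) (fun l => q (X l)) c r i j) =
        ucur r (genEl X (fun l => p (X l)) S i j) := by
  have hrel := RMatAlg.rel (fun l => p (X l)) (fun l => q (X l)) c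
  obtain ⟨H, hH, hF⟩ := hR.exists_isCurrentRep hrel
  have hF' : ∀ r i j, RMatAlg.F (fun l => p (X l)) (fun l => q (X l)) c r i j =
      H r (genEl X (fun l => p (X l)) S i j) := fun r i j => congrFun (congrFun (hF r) i) j
  obtain ⟨φ, hφ⟩ := RMatAlg.exists_lift (hR.modeRel_of_isCurrentRep
    (isCurrentRep_ucurLin (L := 𝔤 × AbelianLie I)))
  obtain ⟨ψ, hψ⟩ := exists_hom_of_isCurrentRep hH
  have hφψ : ∀ r, φ.toLinearMap.comp (H r) = ucurLin r := fun r =>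
    hR.linearMap_ext_genEl fun i j => (congrArg φ (hF' r i j).symm).trans (hφ r i j)
  refine ⟨AlgEquiv.ofAlgHom φ ψ ?_ ?_, hφ⟩
  · have h : ((φ.comp ψ).toLinearMap.comp
        (UniversalEnvelopingAlgebra.ι ℂ (L := Current (𝔤 × AbelianLie I))).toLinearMap) =
        (UniversalEnvelopingAlgebra.ι ℂ (L := Current (𝔤 × AbelianLie I))).toLinearMap :=
      linearMap_ext_cur fun r x =>
        (congrArg φ (hψ r x)).trans (LinearMap.congr_fun (hφψ r) x)
    apply UniversalEnvelopingAlgebra.hom_ext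
    exact LieHom.ext fun x => LinearMap.congr_fun h x
  · refine RMatAlg.hom_ext fun r i j => ?_
    exact (congrArg ψ (hφ r i j)).trans ((hψ r _).trans (hF' r i j).symm)

end IsMatrixRep

end Isomorphisms

/-! ### Modules over the Yangian in matrix form -/

section YangianModules

variable {𝔤 : Type*} [LieRing 𝔤] [LieAlgebra ℂ 𝔤] {Λ : Type*} [Fintype Λ]

/-- The homomorphism of Lie algebras from `𝔤` to the Yangian. -/
noncomputable def Yangian.elHom (B : LinearMap.BilinForm ℂ 𝔤) (X : Λ → 𝔤) :
    𝔤 →ₗ⁅ℂ⁆ Yangian B X where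
  toFun := Yangian.el B X
  map_add' x y := by
    have h := RingQuot.mkAlgHom_rel ℂ (YRel.el_lin (B := B) (X := X) 1 1 x y)
    rw [map_add] at h
    simp only [one_smul] at h
    exact h
  map_smul' a x := by
    have h := RingQuot.mkAlgHom_rel ℂ (YRel.el_lin (B := B) (X := X) a 0 x 0)
    rw [map_add, map_smul, map_smul] at h
    simp only [zero_smul, add_zero] at h
    exact h
  map_lie' {x y} := by
    have h := RingQuot.mkAlgHom_rel ℂ (YRel.el_lie (B := B) (X := X) x y)
    rw [map_sub, map_mul, map_mul] at h
    exact h.symm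

/-- The linear map `J` from `𝔤` to the Yangian. -/
noncomputable def Yangian.JLin (B : LinearMap.BilinForm ℂ 𝔤) (X : Λ → 𝔤) :
    𝔤 →ₗ[ℂ] Yangian B X where
  toFun := Yangian.J B X
  map_add' x y := by
    have h := RingQuot.mkAlgHom_rel ℂ (YRel.J_lin (B := B) (X := X) 1 1 x y)
    rw [map_add] at h
    simp only [one_smul] at h
    exact h
  map_smul' a x := by
    have h := RingQuot.mkAlgHom_rel ℂ (YRel.J_lin (B := B) (X := X) a 0 x 0)
    rw [map_add, map_smul, map_smul] at h
    simp only [zero_smul, add_zero] at h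
    exact h

variable {B : LinearMap.BilinForm ℂ 𝔤}

theorem Yangian.J_lie (X : Λ → 𝔤) (x y : 𝔤) :
    Yangian.J B X ⁅x, y⁆ = ⁅Yangian.J B X x, Yangian.el B X y⁆ := by
  have h := RingQuot.mkAlgHom_rel ℂ (YRel.J_lie (B := B) (X := X) x y)
  rw [Ring.lie_def, map_sub, map_mul, map_mul] at h
  exact h

theorem Yangian.commute_of_commute_generators {X : Λ → 𝔤} {A : Type*} [Ring A] [Algebra ℂ A]
    (π : Yangian B X →ₐ[ℂ] A) {a : A} (h₁ : ∀ x, Commute (π (Yangian.el B X x)) a)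
    (h₂ : ∀ x, Commute (π (Yangian.J B X x)) a) (y : Yangian B X) : Commute (π y) a := by
  refine commute_of_adjoin_eq_top (adjoin_mkAlgHom_eq_top (YRel B X)) ?_ y
  rintro _ ⟨x | x, rfl⟩
  · exact h₁ x
  · exact h₂ x

variable [LieAlgebra.IsSimple ℂ 𝔤] {V : Type*} [AddCommGroup V] [Module ℂ V]

/-- If the kernel of `𝔤 → End V` is not zero, then `𝔤` acts by zero because it is simple, and
so does `J(𝔤)`, because `J([x, y]) = [J(x), y]` and `𝔤` is spanned by brackets. -/
theorem injective_of_hasNontrivialIrreducibleSubmodule {X : Λ → 𝔤}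
    {ρ : Yangian B X →ₐ[ℂ] Module.End ℂ V} (hρ : HasNontrivialIrreducibleSubmodule ρ) :
    Function.Injective fun x => ρ (Yangian.el B X x) := by
  let f : 𝔤 →ₗ⁅ℂ⁆ Module.End ℂ V := ρ.toLieHom.comp (Yangian.elHom B X)
  rcases LieAlgebra.IsSimple.eq_bot_or_eq_top (R := ℂ) f.ker with h | h
  · exact f.ker_eq_bot.mp h
  · have hf : ∀ x, ρ (Yangian.el B X x) = 0 := fun x => by
      have hx : x ∈ f.ker := h ▸ LieSubmodule.mem_top x
      exact hx
    have hJ : ρ.toLinearMap.comp (Yangian.JLin B X) = 0 := by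
      refine linearMap_eq_zero_of_lie _ fun x y => ?_
      change ρ (Yangian.J B X ⁅x, y⁆) = 0
      rw [Yangian.J_lie, Ring.lie_def, map_sub, map_mul, map_mul, hf, mul_zero, zero_mul, sub_zero]
    obtain ⟨W, -, -, -, x, w, -, hw⟩ := hρ
    rcases hw with hw | hw
    · exact absurd (by rw [hf]; rfl) hw
    · exact absurd (LinearMap.congr_fun (LinearMap.congr_fun hJ x) w) hw

/-- A module over the Yangian, written in matrices with respect to a basis of the module. -/
theorem exists_isMatrixRep [DecidableEq Λ] {X : Module.Basis Λ ℂ 𝔤}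
    (hBsymm : ∀ x y, B x y = B y x) (hBinv : ∀ x y z, B ⁅x, y⁆ z = B x ⁅y, z⁆)
    (hX : ∀ l m, B (X l) (X m) = if l = m then 1 else 0)
    {c : ℂ} (hc : (adCasimir X).HasEigenvalue c) {ι : Type*} [Fintype ι] [DecidableEq ι]
    (e : Module.Basis ι ℂ V) {ρ : Yangian B X →ₐ[ℂ] Module.End ℂ V}
    (hρ : HasNontrivialIrreducibleSubmodule ρ) {I : Type*} [Fintype I]
    (b : Module.Basis I ℂ (endY ρ)) :
    ∃ (p : 𝔤 →ₗ⁅ℂ⁆ Matrix ι ι ℂ) (q : 𝔤 →ₗ[ℂ] Matrix ι ι ℂ),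
      (∀ x, p x = LinearMap.toMatrix e e (ρ (Yangian.el B X x))) ∧
      (∀ x, q x = LinearMap.toMatrix e e (ρ (Yangian.J B X x))) ∧
      IsMatrixRep B X c p q fun l => LinearMap.toMatrix e e (b l : Module.End ℂ V) := by
  let m : Module.End ℂ V ≃ₐ[ℂ] Matrix ι ι ℂ := LinearMap.toMatrixAlgEquiv e
  let π : Yangian B X →ₐ[ℂ] Matrix ι ι ℂ := (m : Module.End ℂ V →ₐ[ℂ] Matrix ι ι ℂ).comp ρ
  have hb : ∀ y l, Commute (π y) (m (b l)) := fun y l =>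
    Commute.map ((Subalgebra.mem_centralizer_iff ℂ).mp (b l).2 _ ⟨y, rfl⟩) m
  refine ⟨π.toLieHom.comp (Yangian.elHom B X), π.toLinearMap.comp (Yangian.JLin B X),
    fun x => rfl, fun x => rfl, ?_⟩
  exact
    { symm := hBsymm
      inv := hBinv
      orth := hX
      casimir := adCasimir_eq_smul hBinv hBsymm hX hc
      ne_zero := casimir_eigenvalue_ne_zero hBinv hBsymm hX hc
      p_inj := m.injective.comp (injective_of_hasNontrivialIrreducibleSubmodule hρ)
      q_lie := fun x y => by
        change π (Yangian.J B X ⁅x, y⁆) = ⁅π (Yangian.J B X x), π (Yangian.el B X y)⁆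
        rw [Yangian.J_lie, Ring.lie_def, Ring.lie_def, map_sub, map_mul, map_mul]
      lie_p_S := fun x l => (hb (Yangian.el B X x) l).lie_eq
      lie_q_S := fun x l => (hb (Yangian.J B X x) l).lie_eq
      S_indep := (b.linearIndependent.map' (endY ρ).subtype (Submodule.ker_subtype _)).map'
        (LinearMap.toMatrix e e).toLinearMap (LinearEquiv.ker _)
      S_span := fun M h₁ h₂ => by
        have hM : m.symm M ∈ endY ρ := by
          refine (Subalgebra.mem_centralizer_iff ℂ).mpr ?_
          rintro _ ⟨y, rfl⟩
          have h3 := Commute.map (Yangian.commute_of_commute_generators π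
            (fun x => commute_iff_lie_eq.mpr (h₁ x)) (fun x => commute_iff_lie_eq.mpr (h₂ x)) y)
            m.symm
          rwa [show m.symm (π y) = ρ y from m.symm_apply_apply _] at h3
        refine ⟨fun l => b.repr ⟨m.symm M, hM⟩ l, ?_⟩
        have h4 := congrArg (fun T : endY ρ => m T) (b.sum_repr ⟨m.symm M, hM⟩)
        simp only [Submodule.coe_sum, Submodule.coe_smul, map_sum, map_smul,
          AlgEquiv.apply_symm_apply] at h4
        ext i j
        refine (congrFun (congrFun h4.symm i) j).trans ?_
        rw [comb_apply, Matrix.sum_apply]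
        refine Finset.sum_congr rfl fun l _ => ?_
        exact mul_comm _ _ }

end YangianModules

end ExtCurrent

open ExtCurrent

theorem proposition4p11
    -- a finite-dimensional simple Lie algebra with a nondegenerate invariant symmetric form
    {𝔤 : Type*} [LieRing 𝔤] [LieAlgebra ℂ 𝔤] [LieAlgebra.IsSimple ℂ 𝔤]
    (B : LinearMap.BilinForm ℂ 𝔤) (hBsymm : ∀ x y, B x y = B y x) (hBnondeg : B.Nondegenerate)
    (hBinv : ∀ x y z, B ⁅x, y⁆ z = B x ⁅y, z⁆)
    -- an orthonormal basis
    {Λ : Type*} [Fintype Λ] [DecidableEq Λ] (X : Module.Basis Λ ℂ 𝔤)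
    (hX : ∀ l m, B (X l) (X m) = if l = m then 1 else 0)
    -- the eigenvalue of the Casimir element in the adjoint representation
    (c : ℂ) (hc : (adCasimir X).HasEigenvalue c)
    -- a finite-dimensional module over the Yangian, with a basis of the underlying space
    {V : Type*} [AddCommGroup V] [Module ℂ V] {ι : Type*} [Fintype ι] [DecidableEq ι]
    (e : Module.Basis ι ℂ V) (ρ : Yangian B X →ₐ[ℂ] Module.End ℂ V)
    (hρ : HasNontrivialIrreducibleSubmodule ρ)
    -- a basis of the space of endomorphisms of this module
    {I : Type*} [Fintype I] (b : Module.Basis I ℂ (endY ρ))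
    -- the matrices of the operators of `X_l` and `J(X_l)`, and of the basis elements `b l`
    (P Q : Λ → Matrix ι ι ℂ) (S : I → Matrix ι ι ℂ)
    (hP : ∀ l, P l = LinearMap.toMatrix e e (ρ (Yangian.el B X (X l))))
    (hQ : ∀ l, Q l = LinearMap.toMatrix e e (ρ (Yangian.J B X (X l))))
    (hS : ∀ l, S l = LinearMap.toMatrix e e (b l : Module.End ℂ V)) :
    -- `U_ρ(𝔤) ≅ U(𝔤)` and `U_I(𝔤) ≅ ℂ[𝒦_l : l ∈ I] ⊗ U_ρ(𝔤)`
    (∃ φ : URho P c ≃ₐ[ℂ] UniversalEnvelopingAlgebra ℂ 𝔤, ∀ i j,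
      φ (URho.F P c i j) = -∑ l, P l i j • UniversalEnvelopingAlgebra.ι ℂ (X l)) ∧
    (∃ φ : UI P Q c ≃ₐ[ℂ] MvPolynomial I ℂ ⊗[ℂ] URho P c, ∀ i j,
      φ (UI.F P Q c i j) =
        1 ⊗ₜ[ℂ] URho.F P c i j + (∑ l, S l i j • MvPolynomial.X l) ⊗ₜ[ℂ] 1) ∧
    -- `𝔤_I ≅ 𝔤 ⊕ 𝔷_I` and `U(𝔤_I) ≅ U_I(𝔤)`, where `dim 𝔷_I = dim End_{Y(𝔤)} V`
    (∃ φ : gI P Q c ≃ₗ⁅ℂ⁆ 𝔤 × AbelianLie I, ∀ i j,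
      φ (gI.F P Q c i j) = (-∑ l, P l i j • X l, ∑ l, S l i j • AbelianLie.K l)) ∧
    Function.Bijective (UniversalEnvelopingAlgebra.lift ℂ (gI P Q c).incl) ∧
    Module.finrank ℂ (AbelianLie I) = Module.finrank ℂ (endY ρ) ∧
    -- `U(𝔤_I[z]) ≅ U((𝔤 ⊕ 𝔷_I)[z])`
    (∃ φ : UniversalEnvelopingAlgebra ℂ (Current (gI P Q c)) ≃ₐ[ℂ]
        UniversalEnvelopingAlgebra ℂ (Current (𝔤 × AbelianLie I)), ∀ r i j,
      φ (ucur r (gI.F P Q c i j)) =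
        ucur r (-∑ l, P l i j • X l, ∑ l, S l i j • AbelianLie.K l)) ∧
    -- `U(𝔤_I[z])` is presented by the `r`-matrix relations
    (∃ φ : RMatAlg P Q c ≃ₐ[ℂ] UniversalEnvelopingAlgebra ℂ (Current (gI P Q c)), ∀ r i j,
      φ (RMatAlg.F P Q c r i j) = ucur r (gI.F P Q c i j)) ∧
    -- these are equivalent to the relations on the modes `F^{(r)}`, `K^{(r)}`
    (∀ (A : Type*) [Ring A] [Algebra ℂ A] (F : ℕ → Matrix ι ι A),
      ((∀ r s, ⁅mat₁ (F r), mat₂ (F s)⁆ = ⁅scal A (tens P P), mat₂ (F (r + s))⁆) ∧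
        (∀ r, ⁅mat₂ (kMat P c (F r)), scal A (tens P Q)⁆ =
          ⁅mat₁ (kMat P c (F r)), scal A (tens Q P)⁆)) ↔
      (rLeft F = rRight P F ∧ kLeft P Q c F = kRight P Q c F)) := by
  obtain ⟨p, q, hp, hq, hR⟩ := exists_isMatrixRep hBsymm hBinv hX hc e hρ b
  obtain rfl : P = fun l => p (X l) := funext fun l => (hP l).trans (hp (X l)).symm
  obtain rfl : Q = fun l => q (X l) := funext fun l => (hQ l).trans (hq (X l)).symm
  obtain rfl := funext hS
  obtain ⟨⟨φ, hφ⟩, hincl⟩ := hR.exists_gI_equiv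
  have hφcur : ∀ r i j, uEquiv (curEquiv φ) (ucur r (gI.F _ _ c i j)) =
      ucur r (genEl X (fun l => p (X l)) _ i j) := fun r i j => by
    rw [ucur, uEquiv_ι, curEquiv_cur, hφ, ucur]
  refine ⟨hR.exists_URho_equiv, hR.exists_UI_equiv_tensor, ⟨φ, hφ⟩, hincl, ?_,
    ⟨uEquiv (curEquiv φ), hφcur⟩, ?_, fun A _ _ F => modeRel_iff _ _ c F⟩
  · rw [Module.finrank_eq_card_basis (AbelianLie.basis I), Module.finrank_eq_card_basis b]
  · obtain ⟨χ, hχ⟩ := hR.exists_RMatAlg_equiv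
    refine ⟨χ.trans (uEquiv (curEquiv φ)).symm, fun r i j => ?_⟩
    rw [AlgEquiv.trans_apply, hχ, AlgEquiv.symm_apply_eq, hφcur]
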